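/- Let $d\ge 2$, let $S^{d-1}\subset\mathbb R^d$ be the round unit sphere, $d\sigma$ its normalized surface measure ($\int_{S^{d-1}}d\sigma=1$), $\nabla_\sigma$ the spherical gradient and $\nabla_\sigma^2$ the spherical (covariant) Hessian, and put $$\Gamma_2(g,g)=\|\nabla_\sigma^2 g\|^2+(d-2)|\nabla_\sigma g|^2,$$ where $\|\cdot\|$ is the Hilbert–Schmidt norm. Let $\Lambda_d$ be the largest constant such that $$\int_{S^{d-1}} f\,\Gamma_2(\log f,\log f)\,d\sigma\ \ge\ \Lambda_d\int_{S^{d-1}} f\,|\nabla_\sigma\log f|^2\,d\sigma$$ holds for every smooth positive function $f:S^{d-1}\to\mathbb R_{>0}$ that is symmetric, i.e. $f(\sigma)=f(-\sigma)$ for every $\sigma\in S^{d-1}$. Then this largest constant exists (as a real number) and $$\Lambda_d\ \ge\ d+3-\frac1{d-1}.$$ In particular, $\Lambda_2\ge 4$ and $\Lambda_3\ge 5.5$. -/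

import Mathlib

open scoped Manifold ContDiff

noncomputable section

/-- The unit sphere `S^{d-1}` in the Euclidean space `ℝ^d`. -/
abbrev UnitSphere (d : ℕ) : Type :=
  Metric.sphere (0 : EuclideanSpace ℝ (Fin d)) 1

/-- `S^{d-1}` carries Mathlib's manifold structure of dimension `d - 1`. -/
instance finrankEuclideanSpaceFact (d : ℕ) [NeZero d] :
    Fact (Module.finrank ℝ (EuclideanSpace ℝ (Fin d)) = (d - 1) + 1) :=
  ⟨by rw [finrank_euclideanSpace_fin, Nat.sub_add_cancel (NeZero.one_le)]⟩

/-- The normalized surface measure of `S^{d-1}`, of total mass one for `d ≥ 1`. -/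
def sphereMeasure (d : ℕ) : MeasureTheory.Measure (UnitSphere d) :=
  ((MeasureTheory.volume : MeasureTheory.Measure (EuclideanSpace ℝ (Fin d))).toSphere
      Set.univ)⁻¹ •
    (MeasureTheory.volume : MeasureTheory.Measure (EuclideanSpace ℝ (Fin d))).toSphere

/-- The extension of `g : S^{d-1} → ℝ` to `ℝ^d ∖ {0}` that is constant along rays,
`x ↦ g (x / ‖x‖)`. The value at the origin is irrelevant. -/
def radialExtension {d : ℕ} (g : UnitSphere d → ℝ) (x : EuclideanSpace ℝ (Fin d)) : ℝ :=
  if hx : x = 0 then 0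
  else g ⟨‖x‖⁻¹ • x, by simp [norm_smul, inv_mul_cancel₀ (norm_ne_zero_iff.mpr hx)]⟩

/-- The spherical gradient `∇_σ g`, as a vector of `ℝ^d`. The radial derivative of the
extension vanishes, so its Euclidean gradient at `σ` is tangent to the sphere. -/
def sphereGradient {d : ℕ} (g : UnitSphere d → ℝ) (σ : UnitSphere d) :
    EuclideanSpace ℝ (Fin d) :=
  gradient (radialExtension g) (σ : EuclideanSpace ℝ (Fin d))

/-- The orthogonal projection of `ℝ^d` onto the tangent space `σ^⊥` of the sphere at `σ`. -/
def tangentProjection {d : ℕ} (σ : UnitSphere d) (u : EuclideanSpace ℝ (Fin d)) :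
    EuclideanSpace ℝ (Fin d) :=
  u - (inner ℝ (σ : EuclideanSpace ℝ (Fin d)) u) • (σ : EuclideanSpace ℝ (Fin d))

/-- The spherical (covariant) Hessian `∇_σ² g` at `σ`, as a bilinear form on `ℝ^d` that vanishes
in the normal direction. The Levi-Civita connection of the sphere is the tangential part of the
Euclidean derivative, so for tangent `u`, `v` the covariant Hessian is `⟨D_u (∇_σ g), v⟩`, which is
the second derivative of the extension evaluated at `u` and `v`. -/
def sphereHessian {d : ℕ} (g : UnitSphere d → ℝ) (σ : UnitSphere d)
    (u v : EuclideanSpace ℝ (Fin d)) : ℝ :=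
  fderiv ℝ (fderiv ℝ (radialExtension g)) (σ : EuclideanSpace ℝ (Fin d))
    (tangentProjection σ u) (tangentProjection σ v)

/-- The squared Hilbert-Schmidt norm `‖∇_σ² g‖²`. -/
def sphereHessianNormSq {d : ℕ} (g : UnitSphere d → ℝ) (σ : UnitSphere d) : ℝ :=
  ∑ i : Fin d, ∑ j : Fin d,
    (sphereHessian g σ (EuclideanSpace.single i 1) (EuclideanSpace.single j 1)) ^ 2

/-- `Γ₂(g, g) = ‖∇_σ² g‖² + (d - 2) |∇_σ g|²` on `S^{d-1}`. -/
def sphereGammaTwo {d : ℕ} (g : UnitSphere d → ℝ) (σ : UnitSphere d) : ℝ :=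
  sphereHessianNormSq g σ + ((d : ℝ) - 2) * ‖sphereGradient g σ‖ ^ 2

/-- The class of test functions: smooth, positive and symmetric functions on `S^{d-1}`. -/
structure IsPositiveSymmetric {d : ℕ} [NeZero d] (f : UnitSphere d → ℝ) : Prop where
  smooth : ContMDiff (𝓡 (d - 1)) 𝓘(ℝ, ℝ) ∞ f
  pos : ∀ σ, 0 < f σ
  symm : ∀ σ, f (-σ) = f σ

/-- The constants `c` for which
`∫ f Γ₂(log f, log f) dσ ≥ c ∫ f |∇_σ log f|² dσ` for all positive symmetric `f` on `S^{d-1}`. -/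
def gammaTwoConstants (d : ℕ) [NeZero d] : Set ℝ :=
  {c | ∀ f : UnitSphere d → ℝ, IsPositiveSymmetric f →
    c * ∫ σ, f σ * ‖sphereGradient (fun τ => Real.log (f τ)) σ‖ ^ 2 ∂(sphereMeasure d) ≤
      ∫ σ, f σ * sphereGammaTwo (fun τ => Real.log (f τ)) σ ∂(sphereMeasure d)}

/-- The optimal constant `Λ_d`. -/
def optimalGammaTwoConstant (d : ℕ) [NeZero d] : ℝ :=
  sSup (gammaTwoConstants d)

end

/-! Write h = √f and extend it to ℝ^d minus the origin as a function H constant along rays, so that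
every spherical quantity becomes a polynomial in Euclidean partial derivatives of H (and 1/H) on the
sphere. Put G = ∫|∇h|², A = ∫(Δh)², B = ∫h⁻¹|∇h|²Δh and D = ∫h⁻²|∇h|⁴. Then ∫f|∇log f|² = 4G, and
Bochner's formula (`integral_bochner`) together with one integration by parts
(`integral_hessian_gradient_gradient`) gives ∫fΓ₂(log f, log f) = 4(A + B). It remains to bound A +
B below by (d + 3 - 1/(d - 1))G.

Two inequalities suffice. The first is the trace inequality (tr T)² ≤ (d - 1)‖T‖² on the tangent
space, applied to T = ∇²h + c h⁻¹∇h⊗∇h and integrated (`integral_sq_laplacian_add_le`); a suitable c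
controls B from below. The second is the spectral gap for even functions, A ≥ 2dG
(`sphere_poincare_even`), the only place where symmetry enters. A linear combination of the two
gives the constant.

The spectral gap is proved without spherical harmonics. The partial derivatives of K = |x|²H are odd
and homogeneous of degree 1, so the Gaussian Poincaré inequality for odd functions applies to each
of them; polar coordinates transfer it to the sphere, and summing over the derivatives gives the
gap. The Gaussian inequality follows from Wirtinger's inequality on circles: for an independent
Gaussian pair (x, y), an odd W restricted to cos t x + sin t y is π-antiperiodic, hence has mean
zero, and the law of the pair is rotation invariant.

Integration by parts on the sphere comes from the vanishing of ∫∂ᵢY over ℝ^d, for Y a radial cutoff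
times a function that is constant along rays. -/

/-! ### Wirtinger's inequality on the circle. -/

open MeasureTheory in
/-- **Wirtinger's inequality** for `π`-antiperiodic functions. -/
theorem wirtinger_antiperiodic {φ φ' : ℝ → ℝ} (hφ : ∀ t, HasDerivAt φ (φ' t) t)
    (hc : Continuous φ') (hanti : ∀ t, φ (t + Real.pi) = -φ t) :
    ∫ t in (0 : ℝ)..(2 * Real.pi), φ t ^ 2 ≤ ∫ t in (0 : ℝ)..(2 * Real.pi), φ' t ^ 2 := by
  have hpos : (0 : ℝ) < 2 * Real.pi := Real.two_pi_pos
  have hφc : Continuous φ := continuous_iff_continuousAt.2 fun t => (hφ t).continuousAt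
  have hper : φ (2 * Real.pi) = φ 0 := by
    have h1 := hanti 0
    have h2 := hanti Real.pi
    rw [zero_add] at h1
    rw [two_mul, h2, h1, neg_neg]
  have hmean : ∫ t in (0 : ℝ)..(2 * Real.pi), φ t = 0 := by
    rw [← intervalIntegral.integral_add_adjacent_intervals (b := Real.pi)
      (hφc.intervalIntegrable _ _) (hφc.intervalIntegrable _ _)]
    have := intervalIntegral.integral_comp_add_right (a := 0) (b := Real.pi) φ Real.pi
    rw [zero_add, ← two_mul] at this
    rw [← this]
    simp [hanti]
  have memL {g : ℝ → ℝ} (hg : Continuous g) :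
      MemLp (fun t => (g t : ℂ)) 2 (volume.restrict (Set.Ioc 0 (2 * Real.pi))) := by
    have hgc : Continuous fun t => (g t : ℂ) := Complex.continuous_ofReal.comp hg
    refine (memLp_two_iff_integrable_sq_norm hgc.aestronglyMeasurable).2 ?_
    exact ((hgc.norm.pow 2).integrableOn_Icc (a := 0) (b := 2 * Real.pi)).mono_set
      Set.Ioc_subset_Icc_self
  have s1 := hasSum_sq_fourierCoeffOn hpos (memL hφc)
  have s2 := hasSum_sq_fourierCoeffOn hpos (memL hc)
  -- Parseval reduces the claim to single Fourier modes: mode 0 of `φ` vanishes because the two half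
  -- periods cancel, and for n ≠ 0 the coefficient of `φ` is that of `φ'` divided by i n.
  have key (n : ℤ) : ‖fourierCoeffOn hpos (fun t => (φ t : ℂ)) n‖ ^ 2 ≤
      ‖fourierCoeffOn hpos (fun t => (φ' t : ℂ)) n‖ ^ 2 := by
    rcases eq_or_ne n 0 with rfl | hn
    · have : fourierCoeffOn hpos (fun t => (φ t : ℂ)) 0 = 0 := by
        rw [fourierCoeffOn_eq_integral]
        simp only [neg_zero, fourier_zero, one_smul]
        rw [intervalIntegral.integral_ofReal, hmean]
        simp
      rw [this]
      simp
    · rw [fourierCoeffOn_of_hasDerivAt hpos hn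
        (fun x _ => (hφ x).ofReal_comp)
        ((Complex.continuous_ofReal.comp hc).intervalIntegrable _ _)]
      have h1 : (1 : ℝ) ≤ |(n : ℝ)| := by exact_mod_cast Int.one_le_abs hn
      have : (1 / (-2 * (Real.pi : ℂ) * Complex.I * n)) *
          ((fourier (-n)) ((0 : ℝ) : AddCircle (2 * Real.pi - 0)) *
            ((φ (2 * Real.pi) : ℂ) - (φ 0 : ℂ)) -
            (((2 * Real.pi : ℝ) : ℂ) - ((0 : ℝ) : ℂ)) *
              fourierCoeffOn hpos (fun t => (φ' t : ℂ)) n) =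
          (Complex.I * n)⁻¹ * fourierCoeffOn hpos (fun t => (φ' t : ℂ)) n := by
        rw [hper]
        have : (Real.pi : ℂ) ≠ 0 := by exact_mod_cast Real.pi_ne_zero
        have : (n : ℂ) ≠ 0 := by exact_mod_cast hn
        push_cast
        field_simp
        ring
      rw [this, norm_mul, mul_pow]
      refine mul_le_of_le_one_left (by positivity) ?_
      rw [norm_inv, norm_mul, Complex.norm_I, one_mul, Complex.norm_intCast]
      exact pow_le_one₀ (by positivity) (inv_le_one_of_one_le₀ h1)
  have := hasSum_le key s1 s2
  simp only [Complex.norm_real, Real.norm_eq_abs, sq_abs, sub_zero, smul_eq_mul] at this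
  exact le_of_mul_le_mul_left this (by positivity)

-- With values in `ENNReal`, the inequality can be integrated over Gaussian pairs without any
-- integrability assumption.
open MeasureTheory in
theorem lintegral_wirtinger_antiperiodic {φ φ' : ℝ → ℝ} (hφ : ∀ t, HasDerivAt φ (φ' t) t)
    (hc : Continuous φ') (hanti : ∀ t, φ (t + Real.pi) = -φ t) :
    ∫⁻ t in Set.Ioc 0 (2 * Real.pi), ENNReal.ofReal (φ t ^ 2) ≤
      ∫⁻ t in Set.Ioc 0 (2 * Real.pi), ENNReal.ofReal (φ' t ^ 2) := by
  have hφc : Continuous φ := continuous_iff_continuousAt.2 fun t => (hφ t).continuousAt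
  have aux {g : ℝ → ℝ} (hg : Continuous g) :
      ∫⁻ t in Set.Ioc 0 (2 * Real.pi), ENNReal.ofReal (g t ^ 2) =
        ENNReal.ofReal (∫ t in (0 : ℝ)..(2 * Real.pi), g t ^ 2) := by
    rw [intervalIntegral.integral_of_le Real.two_pi_pos.le,
      ofReal_integral_eq_lintegral_ofReal _ (Filter.Eventually.of_forall fun t => sq_nonneg _)]
    exact ((hg.pow 2).integrableOn_Icc (a := 0) (b := 2 * Real.pi)).mono_set
      Set.Ioc_subset_Icc_self
  rw [aux hφc, aux hc]
  exact ENNReal.ofReal_le_ofReal (wirtinger_antiperiodic hφ hc hanti)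

/-! ### Gaussian measure and the Poincaré inequality for odd functions. -/

section GaussianPoincare

open MeasureTheory ProbabilityTheory
open scoped RealInnerProductSpace

variable {V : Type*} [NormedAddCommGroup V] [InnerProductSpace ℝ V] [FiniteDimensional ℝ V]
  [MeasurableSpace V] [BorelSpace V]

/-- Both measures are finite and have the same characteristic function. The density gives access to
polar coordinates and to Lebesgue null sets. -/
theorem stdGaussian_eq_withDensity :
    stdGaussian V = (volume : Measure V).withDensity fun x =>
      ENNReal.ofReal (((2 * Real.pi) ^ ((Module.finrank ℝ V : ℝ) / 2))⁻¹ *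
        Real.exp (-(‖x‖ ^ 2) / 2)) := by
  set c : ℝ := ((2 * Real.pi) ^ ((Module.finrank ℝ V : ℝ) / 2)) with hc
  have hcpos : 0 < c := Real.rpow_pos_of_pos Real.two_pi_pos _
  have hint : Integrable fun x : V => c⁻¹ * Real.exp (-(‖x‖ ^ 2) / 2) := by
    refine Integrable.const_mul ?_ _
    have h := GaussianFourier.integral_rexp_neg_mul_sq_norm (V := V) (b := 1 / 2) (by norm_num)
    -- Integrability comes for free: the integral of a non-integrable function is 0 by convention,
    -- and this one is not 0.
    have hne : (∫ v : V, Real.exp (-(1 / 2 : ℝ) * ‖v‖ ^ 2)) ≠ 0 := by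
      rw [h]
      positivity
    refine (Integrable.congr (by_contra fun hn => hne (integral_undef hn)) ?_)
    exact Filter.Eventually.of_forall fun x => by
      simp only
      congr 1
      ring
  have : IsFiniteMeasure ((volume : Measure V).withDensity fun x =>
      ENNReal.ofReal (c⁻¹ * Real.exp (-(‖x‖ ^ 2) / 2))) :=
    isFiniteMeasure_withDensity_ofReal hint.2
  refine Measure.ext_of_charFun (funext fun t => ?_)
  rw [charFun_stdGaussian, charFun_apply, integral_withDensity_eq_integral_toReal_smul (by fun_prop)
    (Filter.Eventually.of_forall fun _ => ENNReal.ofReal_lt_top)]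
  have h := GaussianFourier.integral_cexp_neg_mul_sq_norm_add (V := V) (b := 1 / 2) (by norm_num)
    Complex.I t
  have e : ∀ x : V, (ENNReal.ofReal (c⁻¹ * Real.exp (-(‖x‖ ^ 2) / 2))).toReal •
      Complex.exp ((⟪x, t⟫ : ℝ) * Complex.I) =
      (c : ℂ)⁻¹ * Complex.exp (-(1 / 2) * (‖x‖ : ℂ) ^ 2 + Complex.I * (⟪t, x⟫ : ℝ)) := by
    intro x
    rw [ENNReal.toReal_ofReal (by positivity), Complex.real_smul, real_inner_comm]
    push_cast
    rw [mul_assoc, ← Complex.exp_add]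
    congr 2
    ring
  simp_rw [e]
  rw [integral_const_mul, h]
  have hc' : ((Real.pi : ℂ) / (1 / 2)) ^ ((Module.finrank ℝ V : ℂ) / 2) = (c : ℂ) := by
    rw [hc, Complex.ofReal_cpow Real.two_pi_pos.le]
    push_cast
    congr 1
    ring
  rw [hc', ← mul_assoc, inv_mul_cancel₀ (by exact_mod_cast hcpos.ne'), one_mul]
  congr 1
  rw [Complex.I_sq]
  ring

/-- This is the variance of a centred linear form. It integrates out the second variable in the
Poincaré inequality, where L is the derivative at the first one. -/
theorem lintegral_sq_strongDual_stdGaussian (L : StrongDual ℝ V) :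
    ∫⁻ y, ENNReal.ofReal (L y ^ 2) ∂(stdGaussian V) = ENNReal.ofReal (‖L‖ ^ 2) := by
  have h := variance_dual_stdGaussian L
  rw [variance_eq_integral (by fun_prop), integral_strongDual_stdGaussian] at h
  simp only [sub_zero] at h
  rw [← h, ofReal_integral_eq_lintegral_ofReal _ (Filter.Eventually.of_forall fun _ => sq_nonneg _)]
  exact (IsGaussian.memLp_dual (stdGaussian V) L 2 (by simp)).integrable_sq

theorem stdGaussian_absolutelyContinuous : stdGaussian V ≪ (volume : Measure V) := by
  rw [stdGaussian_eq_withDensity]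
  exact withDensity_absolutelyContinuous _ _

/-- Two independent Gaussian vectors are almost surely linearly independent, that is, their Gram
determinant is nonzero. Almost every random circle thus avoids the singularity at the origin. -/
theorem ae_forall_cos_smul_add_sin_smul_ne_zero (hV : 2 ≤ Module.finrank ℝ V) :
    ∀ᵐ p ∂((stdGaussian V).prod (stdGaussian V)), ∀ t : ℝ,
      Real.cos t • p.1 + Real.sin t • p.2 ≠ 0 := by
  have hgram : (stdGaussian V).prod (stdGaussian V)
      {p : V × V | ‖p.1‖ ^ 2 * ‖p.2‖ ^ 2 - ⟪p.1, p.2⟫ ^ 2 = 0} = 0 := by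
    refine Measure.measure_prod_null_of_ae_null
      (isClosed_eq (by fun_prop) continuous_const).measurableSet ?_
    have h0 : ∀ᵐ x ∂(stdGaussian V), x ≠ 0 := by
      have : Nontrivial V := Module.nontrivial_of_finrank_pos (R := ℝ) (by omega)
      have : ∀ᵐ x ∂(volume : Measure V), x ≠ 0 := by simp [ae_iff]
      exact stdGaussian_absolutelyContinuous.ae_le this
    filter_upwards [h0] with x hx
    -- For fixed x ≠ 0, equality in Cauchy–Schwarz puts y on the line through x, which is null in
    -- dimension at least 2.
    refine stdGaussian_absolutelyContinuous (measure_mono_null (t := (ℝ ∙ x : Submodule ℝ V)) ?_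
      (Measure.addHaar_submodule _ _ ?_))
    · intro y hy
      have hy' : ‖x‖ ^ 2 * ‖y‖ ^ 2 - ⟪x, y⟫ ^ 2 = 0 := hy
      have : ‖⟪x, y⟫‖ = ‖x‖ * ‖y‖ := by
        rw [Real.norm_eq_abs, ← abs_of_nonneg (show 0 ≤ ‖x‖ * ‖y‖ by positivity), ← sq_eq_sq_iff_abs_eq_abs]
        linarith [mul_pow ‖x‖ ‖y‖ 2]
      exact (((norm_inner_eq_norm_tfae ℝ x y).out 0 3 :).1 this).resolve_left hx
    · intro htop
      have h1 := finrank_span_singleton (K := ℝ) hx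
      rw [htop, finrank_top] at h1
      omega
  filter_upwards [compl_mem_ae_iff.2 hgram] with p hp t ht
  apply hp
  have h1 : Real.cos t * ‖p.1‖ ^ 2 + Real.sin t * ⟪p.1, p.2⟫ = 0 := by
    have := congrArg (fun v => ⟪p.1, v⟫) ht
    simpa [inner_add_right, inner_smul_right] using this
  have h2 : Real.cos t * ⟪p.1, p.2⟫ + Real.sin t * ‖p.2‖ ^ 2 = 0 := by
    have := congrArg (fun v => ⟪p.2, v⟫) ht
    simpa [inner_add_right, inner_smul_right, real_inner_comm] using this
  have h3 := Real.sin_sq_add_cos_sq t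
  show ‖p.1‖ ^ 2 * ‖p.2‖ ^ 2 - ⟪p.1, p.2⟫ ^ 2 = 0
  -- The Gram matrix kills the unit vector (cos t, sin t), so its determinant is 0; the multipliers
  -- of `h1` and `h2` are the entries of (cos t, sin t) times the adjugate.
  linear_combination (-(‖p.1‖ ^ 2 * ‖p.2‖ ^ 2 - ⟪p.1, p.2⟫ ^ 2)) * h3 +
    (Real.sin t * ‖p.1‖ ^ 2 - Real.cos t * ⟪p.1, p.2⟫) * h2 +
    (Real.cos t * ‖p.2‖ ^ 2 - Real.sin t * ⟪p.1, p.2⟫) * h1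

/-- After Tonelli, each rotation of the pair preserves the product Gaussian, so the integrand is
constant in t. -/
theorem lintegral_rotation_stdGaussian {Φ : V × V → ENNReal} (hΦ : Measurable Φ) :
    ∫⁻ p, (∫⁻ t in Set.Ioc 0 (2 * Real.pi), Φ (ContinuousLinearMap.rotation t p))
        ∂((stdGaussian V).prod (stdGaussian V)) =
      ENNReal.ofReal (2 * Real.pi) * ∫⁻ p, Φ p ∂((stdGaussian V).prod (stdGaussian V)) := by
  have hm : Measurable fun q : (V × V) × ℝ => ContinuousLinearMap.rotation q.2 q.1 := by
    simp only [ContinuousLinearMap.rotation_apply]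
    fun_prop
  rw [lintegral_lintegral_swap (f := fun p t => Φ (ContinuousLinearMap.rotation t p))
    (hΦ.comp hm).aemeasurable]
  have (t : ℝ) : ∫⁻ p, Φ (ContinuousLinearMap.rotation t p)
      ∂((stdGaussian V).prod (stdGaussian V)) =
      ∫⁻ p, Φ p ∂((stdGaussian V).prod (stdGaussian V)) := by
    conv_rhs => rw [← IsGaussian.map_rotation_eq_self (μ := stdGaussian V)
      (by simp [integral_id_stdGaussian]) t]
    rw [lintegral_map hΦ (ContinuousLinearMap.continuous _).measurable]
  simp only [this]
  rw [setLIntegral_const, Real.volume_Ioc, sub_zero, mul_comm]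

/-- The **Gaussian Poincaré inequality** for odd functions, with an admissible singularity at the
origin. -/
theorem gaussian_poincare_odd (hV : 2 ≤ Module.finrank ℝ V) {W : V → ℝ}
    (hW : ContDiffOn ℝ 1 W {0}ᶜ) (hodd : ∀ x, W (-x) = -W x) :
    ∫⁻ x, ENNReal.ofReal (W x ^ 2) ∂(stdGaussian V) ≤
      ∫⁻ x, ENNReal.ofReal (‖fderiv ℝ W x‖ ^ 2) ∂(stdGaussian V) := by
  have hopen : IsOpen ({0}ᶜ : Set V) := isOpen_compl_singleton
  have hWm : Measurable W := measurable_of_continuousOn_compl_singleton 0 hW.continuousOn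
  have hdm : Measurable fun p : V × V => fderiv ℝ W p.1 p.2 := by
    have h : Measurable fun p : V × V => fderiv ℝ W p.1 :=
      (measurable_fderiv ℝ W).comp measurable_fst
    exact (ContinuousLinearMap.measurable_apply₂ (E := V) (F := ℝ)).comp (h.prodMk measurable_snd)
  have h1 : ∫⁻ p, (∫⁻ t in Set.Ioc 0 (2 * Real.pi),
        (fun q : V × V => ENNReal.ofReal (W q.1 ^ 2)) (ContinuousLinearMap.rotation t p))
        ∂((stdGaussian V).prod (stdGaussian V)) ≤
      ∫⁻ p, (∫⁻ t in Set.Ioc 0 (2 * Real.pi),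
        (fun q : V × V => ENNReal.ofReal (fderiv ℝ W q.1 q.2 ^ 2))
          (ContinuousLinearMap.rotation t p))
        ∂((stdGaussian V).prod (stdGaussian V)) := by
    refine lintegral_mono_ae ?_
    filter_upwards [ae_forall_cos_smul_add_sin_smul_ne_zero hV] with p hp
    simp only [ContinuousLinearMap.rotation_apply]
    -- The derivative in t is DW at the first component of the rotated pair, applied to the second
    -- component; it is again a function of the rotated pair.
    refine lintegral_wirtinger_antiperiodic (φ := fun t => W (Real.cos t • p.1 + Real.sin t • p.2))
      (φ' := fun t => fderiv ℝ W (Real.cos t • p.1 + Real.sin t • p.2)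
        (-Real.sin t • p.1 + Real.cos t • p.2)) (fun t => ?_) ?_ fun t => ?_
    · have hd : HasFDerivAt W (fderiv ℝ W (Real.cos t • p.1 + Real.sin t • p.2))
          (Real.cos t • p.1 + Real.sin t • p.2) :=
        ((hW.differentiableOn one_ne_zero).differentiableAt
          (hopen.mem_nhds (hp t))).hasFDerivAt
      exact hd.comp_hasDerivAt t
        (((Real.hasDerivAt_cos t).smul_const p.1).add ((Real.hasDerivAt_sin t).smul_const p.2))
    · have hcd : ContinuousOn (fderiv ℝ W) {0}ᶜ :=
        hW.continuousOn_fderiv_of_isOpen hopen le_rfl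
      have h2 : Continuous fun t : ℝ => fderiv ℝ W (Real.cos t • p.1 + Real.sin t • p.2) :=
        hcd.comp_continuous (by fun_prop) fun t => hp t
      exact h2.clm_apply (by fun_prop)
    · rw [Real.cos_add_pi, Real.sin_add_pi, ← hodd]
      congr 1
      simp only [neg_smul]
      abel
  have hm1 : Measurable fun q : V × V => ENNReal.ofReal (W q.1 ^ 2) := by fun_prop
  have hm2 : Measurable fun q : V × V => ENNReal.ofReal (fderiv ℝ W q.1 q.2 ^ 2) :=
    (hdm.pow_const 2).ennreal_ofReal
  rw [lintegral_rotation_stdGaussian hm1, lintegral_rotation_stdGaussian hm2] at h1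
  have h2 := (ENNReal.mul_le_mul_iff_right (by simp [Real.pi_pos]) ENNReal.ofReal_ne_top).1 h1
  rw [lintegral_prod _ hm1.aemeasurable, lintegral_prod _ hm2.aemeasurable] at h2
  simpa [lintegral_sq_strongDual_stdGaussian] using h2

end GaussianPoincare

/-! ### Polar coordinates for Lebesgue and Gaussian integrals. -/

section Polar

open MeasureTheory ProbabilityTheory
open scoped RealInnerProductSpace

variable {d : ℕ}

theorem lintegral_eq_lintegral_toSphere_prod (F : EuclideanSpace ℝ (Fin d) → ENNReal) [NeZero d] :
    ∫⁻ x, F x = ∫⁻ p : UnitSphere d × Set.Ioi (0 : ℝ), F (p.2.1 • (p.1 : EuclideanSpace ℝ (Fin d)))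
      ∂(volume : Measure (EuclideanSpace ℝ (Fin d))).toSphere.prod
        (Measure.volumeIoiPow (Module.finrank ℝ (EuclideanSpace ℝ (Fin d)) - 1)) := by
  rw [← (Measure.measurePreserving_homeomorphUnitSphereProd volume).lintegral_comp_emb
    (Homeomorph.measurableEmbedding _)]
  have h (x : ({0}ᶜ : Set (EuclideanSpace ℝ (Fin d)))) :
      ((homeomorphUnitSphereProd _ x).2.1 • ((homeomorphUnitSphereProd _ x).1 :
        EuclideanSpace ℝ (Fin d))) = x := by
    rw [← homeomorphUnitSphereProd_symm_apply_coe, Homeomorph.symm_apply_apply]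
  simp only [h]
  rw [lintegral_subtype_comap (measurableSet_singleton _).compl, restrict_compl_singleton]

theorem integral_eq_integral_toSphere_prod (F : EuclideanSpace ℝ (Fin d) → ℝ) [NeZero d] :
    ∫ x, F x = ∫ p : UnitSphere d × Set.Ioi (0 : ℝ), F (p.2.1 • (p.1 : EuclideanSpace ℝ (Fin d)))
      ∂(volume : Measure (EuclideanSpace ℝ (Fin d))).toSphere.prod
        (Measure.volumeIoiPow (Module.finrank ℝ (EuclideanSpace ℝ (Fin d)) - 1)) := by
  rw [← (Measure.measurePreserving_homeomorphUnitSphereProd volume).integral_comp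
    (Homeomorph.measurableEmbedding _)]
  have h (x : ({0}ᶜ : Set (EuclideanSpace ℝ (Fin d)))) :
      ((homeomorphUnitSphereProd _ x).2.1 • ((homeomorphUnitSphereProd _ x).1 :
        EuclideanSpace ℝ (Fin d))) = x := by
    rw [← homeomorphUnitSphereProd_symm_apply_coe, Homeomorph.symm_apply_apply]
  simp only [h]
  rw [integral_subtype_comap (measurableSet_singleton _).compl, restrict_compl_singleton]

theorem toSphere_univ_ne_zero [NeZero d] :
    (volume : Measure (EuclideanSpace ℝ (Fin d))).toSphere Set.univ ≠ 0 := by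
  simp [NeZero.ne d, (Metric.measure_ball_pos volume (0 : EuclideanSpace ℝ (Fin d)) one_pos).ne']

instance isProbabilityMeasure_sphereMeasure [NeZero d] : IsProbabilityMeasure (sphereMeasure d) :=
  ⟨by
    rw [sphereMeasure, Measure.smul_apply, smul_eq_mul,
      ENNReal.inv_mul_cancel toSphere_univ_ne_zero (measure_ne_top _ _)]⟩

theorem toSphere_eq_smul_sphereMeasure [NeZero d] :
    (volume : Measure (EuclideanSpace ℝ (Fin d))).toSphere =
      (volume : Measure (EuclideanSpace ℝ (Fin d))).toSphere Set.univ • sphereMeasure d := by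
  rw [sphereMeasure, smul_smul, ENNReal.mul_inv_cancel toSphere_univ_ne_zero (measure_ne_top _ _),
    one_smul]

instance isOpenPosMeasure_sphereMeasure [NeZero d] : (sphereMeasure d).IsOpenPosMeasure := by
  refine ⟨fun U hU hne h => ?_⟩
  have := congrArg (fun μ : Measure (UnitSphere d) => μ U) (toSphere_eq_smul_sphereMeasure (d := d))
  simp only [Measure.smul_apply, h, smul_zero] at this
  exact hU.measure_ne_zero _ hne this

/-- Expressing the radial factor as an integral of `ρ ‖x‖` over the whole space absorbs the total
area of the sphere, so no explicit radial integral or surface area is needed. -/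
theorem lintegral_polar [NeZero d] {F : EuclideanSpace ℝ (Fin d) → ENNReal}
    {g : UnitSphere d → ENNReal} {ρ : ℝ → ENNReal} (hg : Measurable g) (hρ : Measurable ρ)
    (hF : ∀ (s : UnitSphere d) (r : ℝ), 0 < r →
      F (r • (s : EuclideanSpace ℝ (Fin d))) = g s * ρ r) :
    ∫⁻ x, F x = (∫⁻ s, g s ∂(sphereMeasure d)) *
      ∫⁻ x : EuclideanSpace ℝ (Fin d), ρ ‖x‖ := by
  rw [lintegral_eq_lintegral_toSphere_prod, lintegral_eq_lintegral_toSphere_prod]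
  have h1 (p : UnitSphere d × Set.Ioi (0 : ℝ)) :
      F (p.2.1 • (p.1 : EuclideanSpace ℝ (Fin d))) = g p.1 * ρ p.2 := hF _ _ p.2.2
  have h2 (p : UnitSphere d × Set.Ioi (0 : ℝ)) :
      ρ ‖p.2.1 • (p.1 : EuclideanSpace ℝ (Fin d))‖ = 1 * ρ p.2 := by
    rw [norm_smul, norm_eq_of_mem_sphere, mul_one, Real.norm_of_nonneg (le_of_lt p.2.2), one_mul]
  have hρ' : Measurable fun r : Set.Ioi (0 : ℝ) => ρ r := hρ.comp measurable_subtype_coe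
  simp only [h1, h2]
  rw [lintegral_prod_mul hg.aemeasurable hρ'.aemeasurable,
    lintegral_prod_mul (f := fun _ => 1) aemeasurable_const hρ'.aemeasurable,
    toSphere_eq_smul_sphereMeasure, lintegral_smul_measure]
  simp only [lintegral_const, one_mul, Measure.smul_apply, measure_univ, smul_eq_mul, mul_one]
  ring

theorem integral_polar [NeZero d] {F : EuclideanSpace ℝ (Fin d) → ℝ}
    {g : UnitSphere d → ℝ} {ρ : ℝ → ℝ}
    (hF : ∀ (s : UnitSphere d) (r : ℝ), 0 < r →
      F (r • (s : EuclideanSpace ℝ (Fin d))) = g s * ρ r) :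
    ∫ x, F x = (∫ s, g s ∂(sphereMeasure d)) *
      ∫ x : EuclideanSpace ℝ (Fin d), ρ ‖x‖ := by
  rw [integral_eq_integral_toSphere_prod, integral_eq_integral_toSphere_prod]
  have h1 (p : UnitSphere d × Set.Ioi (0 : ℝ)) :
      F (p.2.1 • (p.1 : EuclideanSpace ℝ (Fin d))) = g p.1 * ρ p.2 := hF _ _ p.2.2
  have h2 (p : UnitSphere d × Set.Ioi (0 : ℝ)) :
      ρ ‖p.2.1 • (p.1 : EuclideanSpace ℝ (Fin d))‖ = 1 * ρ p.2 := by
    rw [norm_smul, norm_eq_of_mem_sphere, mul_one, Real.norm_of_nonneg (le_of_lt p.2.2), one_mul]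
  simp only [h1, h2]
  rw [integral_prod_mul g (fun r : Set.Ioi (0 : ℝ) => ρ r),
    integral_prod_mul (fun _ => 1) (fun r : Set.Ioi (0 : ℝ) => ρ r),
    toSphere_eq_smul_sphereMeasure, integral_smul_measure, integral_smul_measure]
  simp
  ring

theorem lintegral_stdGaussian_polar [NeZero d] {F : EuclideanSpace ℝ (Fin d) → ENNReal}
    {g : UnitSphere d → ENNReal} {ρ : ℝ → ENNReal} (hFm : Measurable F) (hg : Measurable g)
    (hρ : Measurable ρ)
    (hF : ∀ (s : UnitSphere d) (r : ℝ), 0 < r →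
      F (r • (s : EuclideanSpace ℝ (Fin d))) = g s * ρ r) :
    ∫⁻ x, F x ∂(stdGaussian (EuclideanSpace ℝ (Fin d))) = (∫⁻ s, g s ∂(sphereMeasure d)) *
      ∫⁻ x, ρ ‖x‖ ∂(stdGaussian (EuclideanSpace ℝ (Fin d))) := by
  rw [stdGaussian_eq_withDensity]
  set c : ℝ := ((2 * Real.pi) ^ ((Module.finrank ℝ (EuclideanSpace ℝ (Fin d)) : ℝ) / 2))⁻¹
  rw [lintegral_withDensity_eq_lintegral_mul _ (by fun_prop) hFm,
    lintegral_withDensity_eq_lintegral_mul _ (by fun_prop) (by fun_prop)]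
  refine lintegral_polar (ρ := fun r => ENNReal.ofReal (c * Real.exp (-(r ^ 2) / 2)) * ρ r) hg
    (by fun_prop) fun s r hr => ?_
  simp only [Pi.mul_apply, hF s r hr]
  rw [norm_smul, norm_eq_of_mem_sphere, mul_one, Real.norm_of_nonneg hr.le]
  ring

theorem lintegral_norm_sq_stdGaussian :
    ∫⁻ x, ENNReal.ofReal (‖x‖ ^ 2) ∂(stdGaussian (EuclideanSpace ℝ (Fin d))) = d := by
  have h (x : EuclideanSpace ℝ (Fin d)) : ENNReal.ofReal (‖x‖ ^ 2) =
      ∑ i, ENNReal.ofReal ((innerSL ℝ (EuclideanSpace.single i (1 : ℝ)) x) ^ 2) := by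
    rw [EuclideanSpace.norm_sq_eq, ENNReal.ofReal_sum_of_nonneg fun _ _ => sq_nonneg _]
    simp [EuclideanSpace.inner_single_left]
  simp only [h]
  rw [lintegral_finsetSum _ fun i _ => by fun_prop]
  simp only [lintegral_sq_strongDual_stdGaussian, innerSL_apply_norm, PiLp.norm_single]
  simp

end Polar

/-! ### Partial derivatives and homogeneous functions off the origin. -/

section Calculus

open MeasureTheory ProbabilityTheory
open scoped RealInnerProductSpace

variable {d : ℕ}

/-- The `i`-th partial derivative of a function on `ℝ^d`. -/
noncomputable def pderiv (i : Fin d) (F : EuclideanSpace ℝ (Fin d) → ℝ) :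
    EuclideanSpace ℝ (Fin d) → ℝ :=
  fun x => fderiv ℝ F x (EuclideanSpace.single i 1)

/-- Smoothness away from the origin. -/
abbrev SmoothOff (F : EuclideanSpace ℝ (Fin d) → ℝ) : Prop :=
  ContDiffOn ℝ ∞ F {0}ᶜ

/-- Homogeneity of degree `k` under positive dilations, away from the origin. -/
def HomogeneousOff (k : ℤ) (F : EuclideanSpace ℝ (Fin d) → ℝ) : Prop :=
  ∀ r : ℝ, 0 < r → ∀ x, x ≠ 0 → F (r • x) = r ^ k * F x

theorem clm_apply_eq_sum (L : EuclideanSpace ℝ (Fin d) →L[ℝ] ℝ) (v : EuclideanSpace ℝ (Fin d)) :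
    L v = ∑ i, v i * L (EuclideanSpace.single i 1) := by
  conv_lhs => rw [← (EuclideanSpace.basisFun (Fin d) ℝ).sum_repr v]
  simp

theorem norm_sq_clm_eq_sum (L : EuclideanSpace ℝ (Fin d) →L[ℝ] ℝ) :
    ‖L‖ ^ 2 = ∑ i, L (EuclideanSpace.single i 1) ^ 2 := by
  rw [← (InnerProductSpace.toDual ℝ _).symm.norm_map L, EuclideanSpace.norm_sq_eq]
  refine Finset.sum_congr rfl fun i _ => ?_
  rw [← InnerProductSpace.toDual_symm_apply, EuclideanSpace.inner_single_right]
  simp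

theorem isOpen_compl_zero : IsOpen ({0}ᶜ : Set (EuclideanSpace ℝ (Fin d))) :=
  isOpen_compl_singleton

namespace SmoothOff

variable {F G : EuclideanSpace ℝ (Fin d) → ℝ}

theorem contDiffAt (hF : SmoothOff F) {x : EuclideanSpace ℝ (Fin d)} (hx : x ≠ 0) :
    ContDiffAt ℝ ∞ F x :=
  ContDiffOn.contDiffAt hF (isOpen_compl_zero.mem_nhds hx)

theorem differentiableAt (hF : SmoothOff F) {x : EuclideanSpace ℝ (Fin d)} (hx : x ≠ 0) :
    DifferentiableAt ℝ F x :=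
  (hF.contDiffAt hx).differentiableAt (by simp)

theorem pderiv (hF : SmoothOff F) (i : Fin d) : SmoothOff (pderiv i F) :=
  (ContDiffOn.fderiv_of_isOpen hF isOpen_compl_zero (m := ∞) (by simp)).clm_apply contDiffOn_const

theorem continuous_sphere (hF : SmoothOff F) :
    Continuous fun s : UnitSphere d => F s :=
  (ContDiffOn.continuousOn hF).comp_continuous continuous_subtype_val fun s => ne_zero_of_mem_unit_sphere s

theorem integrable [NeZero d] (hF : SmoothOff F) :
    Integrable (fun s : UnitSphere d => F s) (sphereMeasure d) :=
  hF.continuous_sphere.integrable_of_hasCompactSupport (HasCompactSupport.of_compactSpace _)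

theorem coord (i : Fin d) : SmoothOff fun x : EuclideanSpace ℝ (Fin d) => x i :=
  (contDiff_euclidean.1 contDiff_id i).contDiffOn

end SmoothOff

section pderiv

variable {F G : EuclideanSpace ℝ (Fin d) → ℝ} {x : EuclideanSpace ℝ (Fin d)}

theorem pderiv_add (i : Fin d) (hF : DifferentiableAt ℝ F x) (hG : DifferentiableAt ℝ G x) :
    pderiv i (fun y => F y + G y) x = pderiv i F x + pderiv i G x := by
  simp only [pderiv]
  rw [fderiv_fun_add hF hG]
  rfl

theorem pderiv_sub (i : Fin d) (hF : DifferentiableAt ℝ F x) (hG : DifferentiableAt ℝ G x) :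
    pderiv i (fun y => F y - G y) x = pderiv i F x - pderiv i G x := by
  simp only [pderiv]
  rw [fderiv_fun_sub hF hG]
  rfl

theorem pderiv_mul (i : Fin d) (hF : DifferentiableAt ℝ F x) (hG : DifferentiableAt ℝ G x) :
    pderiv i (fun y => F y * G y) x = pderiv i F x * G x + F x * pderiv i G x := by
  simp only [pderiv]
  rw [fderiv_fun_mul hF hG]
  simp
  ring

theorem pderiv_sum {ι : Type*} (i : Fin d) (u : Finset ι) {F : ι → EuclideanSpace ℝ (Fin d) → ℝ}
    (hF : ∀ k ∈ u, DifferentiableAt ℝ (F k) x) :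
    pderiv i (fun y => ∑ k ∈ u, F k y) x = ∑ k ∈ u, pderiv i (F k) x := by
  simp only [pderiv]
  rw [fderiv_fun_sum hF]
  simp

theorem pderiv_scomp (i : Fin d) {φ : ℝ → ℝ} {φ' : ℝ} (hφ : HasDerivAt φ φ' (F x))
    (hF : DifferentiableAt ℝ F x) :
    pderiv i (fun y => φ (F y)) x = φ' * pderiv i F x := by
  have := (hφ.comp_hasFDerivAt x hF.hasFDerivAt).fderiv
  simp only [pderiv]
  rw [show (fun y => φ (F y)) = φ ∘ F from rfl, this]
  simp

theorem pderiv_coord (i j : Fin d) :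
    pderiv i (fun y : EuclideanSpace ℝ (Fin d) => y j) x = if i = j then 1 else 0 := by
  have : HasFDerivAt (fun y : EuclideanSpace ℝ (Fin d) => y j)
      (EuclideanSpace.proj j : EuclideanSpace ℝ (Fin d) →L[ℝ] ℝ) x :=
    (EuclideanSpace.proj j : EuclideanSpace ℝ (Fin d) →L[ℝ] ℝ).hasFDerivAt
  simp [pderiv, this.fderiv, eq_comm]

theorem pderiv_congr (i : Fin d) (h : ∀ y, y ≠ 0 → F y = G y) (hx : x ≠ 0) :
    pderiv i F x = pderiv i G x := by
  have : F =ᶠ[nhds x] G := by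
    filter_upwards [isOpen_compl_zero.mem_nhds hx] with y hy using h y hy
  simp only [pderiv]
  rw [this.fderiv_eq]

theorem pderiv_comm (hF : SmoothOff F) (hx : x ≠ 0) (i j : Fin d) :
    pderiv i (pderiv j F) x = pderiv j (pderiv i F) x := by
  have hsymm : IsSymmSndFDerivAt ℝ F x := (hF.contDiffAt hx).isSymmSndFDerivAt (by simp; norm_cast)
  have hd : DifferentiableAt ℝ (fderiv ℝ F) x :=
    ((hF.contDiffAt hx).fderiv_right (m := 1) (by norm_cast)).differentiableAt (by simp)
  have (i j : Fin d) : pderiv i (pderiv j F) x =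
      fderiv ℝ (fderiv ℝ F) x (EuclideanSpace.single i 1) (EuclideanSpace.single j 1) := by
    unfold pderiv
    rw [fderiv_clm_apply hd (differentiableAt_const _)]
    simp
  rw [this, this]
  exact hsymm _ _

theorem HomogeneousOff.pderiv {k : ℤ} (hF : HomogeneousOff k F) (i : Fin d) :
    HomogeneousOff (k - 1) (pderiv i F) := by
  intro r hr x hx
  have h1 : (fun y => F (r • y)) =ᶠ[nhds x] fun y => r ^ k * F y := by
    filter_upwards [isOpen_compl_zero.mem_nhds hx] with y hy using hF r hr y hy
  have h2 := h1.fderiv_eq (𝕜 := ℝ)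
  rw [fderiv_comp_smul, show (fun y => r ^ k * F y) = r ^ k • F from rfl,
    fderiv_const_smul_field] at h2
  have h3 := congrArg (fun L => L (EuclideanSpace.single i 1)) h2
  simp only [FunLike.coe_smul, Pi.smul_apply, smul_eq_mul] at h3
  simp only [_root_.pderiv]
  rw [zpow_sub_one₀ hr.ne', mul_right_comm, ← h3]
  field_simp

/-- Euler's identity: differentiate r ↦ F(r x) at r = 1 in two ways. -/
theorem HomogeneousOff.euler {k : ℤ} (hF : HomogeneousOff k F) (hd : DifferentiableAt ℝ F x)
    (hx : x ≠ 0) : ∑ i, x i * _root_.pderiv i F x = k * F x := by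
  have h1 : HasDerivAt (fun r : ℝ => F (r • x)) (fderiv ℝ F x x) 1 := by
    have hd' : HasFDerivAt F (fderiv ℝ F x) ((1 : ℝ) • x) := by
      simpa using hd.hasFDerivAt
    have h := hd'.comp_hasDerivAt (1 : ℝ) ((hasDerivAt_id (1 : ℝ)).smul_const x)
    rw [one_smul] at h
    exact h
  have h2 : HasDerivAt (fun r : ℝ => r ^ k * F x) (k * F x) 1 := by
    simpa using (hasDerivAt_zpow k (1 : ℝ) (Or.inl one_ne_zero)).mul_const (F x)
  have h3 : (fun r : ℝ => F (r • x)) =ᶠ[nhds 1] fun r : ℝ => r ^ k * F x := by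
    filter_upwards [lt_mem_nhds (zero_lt_one (α := ℝ))] with r hr using hF r hr x hx
  rw [(h2.congr_of_eventuallyEq h3).unique h1, clm_apply_eq_sum]
  rfl

end pderiv

end Calculus

/-! ### The odd Poincaré inequality on the sphere, and radial cutoffs. -/

section SphereIntegrals

open MeasureTheory ProbabilityTheory
open scoped RealInnerProductSpace

variable {d : ℕ}

/-- The **Poincaré inequality** on the sphere for odd functions, in terms of the `1`-homogeneous
extension. -/
theorem sphere_poincare_odd [NeZero d] (hd : 2 ≤ d) {W : EuclideanSpace ℝ (Fin d) → ℝ}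
    (hW : SmoothOff W) (hodd : ∀ x, W (-x) = -W x) (hhom : HomogeneousOff 1 W) :
    d * ∫ s : UnitSphere d, W s ^ 2 ∂(sphereMeasure d) ≤
      ∫ s : UnitSphere d, ∑ i, pderiv i W s ^ 2 ∂(sphereMeasure d) := by
  have h := gaussian_poincare_odd (by simpa using hd) (hW.of_le (by simp)) hodd
  have hWm : Measurable W := measurable_of_continuousOn_compl_singleton 0 hW.continuousOn
  have hWc := hW.continuous_sphere
  have hDc : Continuous fun s : UnitSphere d => ∑ i, pderiv i W s ^ 2 :=
    continuous_finsetSum _ fun i _ => (hW.pderiv i).continuous_sphere.pow 2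
  -- W² has degree 2 and |∇W|² has degree 0, so the radial factors are ∫|x|² = d and 1 respectively.
  -- This is where the factor d arises.
  rw [lintegral_stdGaussian_polar (g := fun s => ENNReal.ofReal (W s ^ 2))
      (ρ := fun r => ENNReal.ofReal (r ^ 2)) (by fun_prop) (by fun_prop) (by fun_prop)
      (fun s r hr => by
        rw [hhom r hr _ (ne_zero_of_mem_unit_sphere s), zpow_one, mul_pow, mul_comm,
          ENNReal.ofReal_mul (sq_nonneg _)]),
    lintegral_stdGaussian_polar (F := fun x => ENNReal.ofReal (‖fderiv ℝ W x‖ ^ 2))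
      (g := fun s => ENNReal.ofReal (∑ i, pderiv i W s ^ 2))
      (ρ := fun r => 1) (by fun_prop) hDc.measurable.ennreal_ofReal (by fun_prop)
      (fun s r hr => by
        rw [norm_sq_clm_eq_sum, mul_one]
        congr 1
        refine Finset.sum_congr rfl fun i _ => ?_
        have := hhom.pderiv i r hr _ (ne_zero_of_mem_unit_sphere s)
        rw [sub_self, zpow_zero, one_mul] at this
        rw [← this]
        rfl),
    lintegral_norm_sq_stdGaussian, lintegral_one, measure_univ, mul_one,
    ← ofReal_integral_eq_lintegral_ofReal
      (f := fun s : UnitSphere d => W s ^ 2) ((hWc.pow 2).integrable_of_hasCompactSupport (HasCompactSupport.of_compactSpace _))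
      (Filter.Eventually.of_forall fun _ => sq_nonneg _),
    ← ofReal_integral_eq_lintegral_ofReal
      (hDc.integrable_of_hasCompactSupport (HasCompactSupport.of_compactSpace _))
      (Filter.Eventually.of_forall fun _ => Finset.sum_nonneg fun _ _ => sq_nonneg _),
    ← ENNReal.ofReal_natCast, ← ENNReal.ofReal_mul (integral_nonneg fun _ => sq_nonneg _)] at h
  rw [mul_comm]
  exact (ENNReal.ofReal_le_ofReal_iff
    (integral_nonneg fun _ => Finset.sum_nonneg fun _ _ => sq_nonneg _)).1 h

/-- A radial cutoff profile, applied to the squared norm. -/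
noncomputable def radialBump : ContDiffBump (2 : ℝ) := ⟨1 / 2, 1, by norm_num, by norm_num⟩

theorem radialBump_eventually_eq_zero :
    (fun x : EuclideanSpace ℝ (Fin d) => radialBump (‖x‖ ^ 2)) =ᶠ[nhds 0] fun _ => 0 := by
  have : Continuous fun x : EuclideanSpace ℝ (Fin d) => ‖x‖ ^ 2 := by fun_prop
  have h := this.continuousAt (x := 0)
  rw [ContinuousAt, norm_zero, zero_pow two_ne_zero] at h
  filter_upwards [h (gt_mem_nhds (zero_lt_one (α := ℝ)))] with x hx
  refine radialBump.zero_of_le_dist ?_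
  have : ‖x‖ ^ 2 < 1 := hx
  rw [Real.dist_eq, abs_sub_comm]
  exact le_trans (by simp only [radialBump]; linarith) (le_abs_self _)

theorem hasCompactSupport_radialBump :
    HasCompactSupport fun x : EuclideanSpace ℝ (Fin d) => radialBump (‖x‖ ^ 2) := by
  refine HasCompactSupport.intro (isCompact_closedBall 0 2) fun x hx => ?_
  have hx' : 2 < ‖x‖ := by simpa using hx
  refine radialBump.zero_of_le_dist ?_
  rw [Real.dist_eq]
  exact le_trans (by simp only [radialBump]; nlinarith) (le_abs_self _)

theorem contDiff_radialBump_mul {F : EuclideanSpace ℝ (Fin d) → ℝ} (hF : SmoothOff F) :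
    ContDiff ℝ ∞ fun x => radialBump (‖x‖ ^ 2) * F x := by
  refine contDiff_iff_contDiffAt.2 fun x => ?_
  rcases eq_or_ne x 0 with rfl | hx
  · refine (contDiffAt_const (c := (0 : ℝ))).congr_of_eventuallyEq ?_
    filter_upwards [radialBump_eventually_eq_zero] with y hy
    rw [hy, zero_mul]
  · exact ((radialBump.contDiff.comp (contDiff_norm_sq ℝ)).contDiffAt).mul (hF.contDiffAt hx)

theorem integrable_radialBump_mul {F : EuclideanSpace ℝ (Fin d) → ℝ} (hF : SmoothOff F) :
    Integrable fun x => radialBump (‖x‖ ^ 2) * F x :=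
  (contDiff_radialBump_mul hF).continuous.integrable_of_hasCompactSupport
    hasCompactSupport_radialBump.mul_right

theorem integral_pderiv_eq_zero {Y : EuclideanSpace ℝ (Fin d) → ℝ} (hY : ContDiff ℝ ∞ Y)
    (hc : HasCompactSupport Y) (i : Fin d) : ∫ x, pderiv i Y x = 0 := by
  have h1 : Integrable (fun x => pderiv i Y x) :=
    ((hY.continuous_fderiv (by simp)).clm_apply
      continuous_const).integrable_of_hasCompactSupport (hc.fderiv_apply (𝕜 := ℝ) _)
  have h := integral_mul_fderiv_eq_neg_fderiv_mul_of_integrable (μ := volume)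
    (f := fun _ : EuclideanSpace ℝ (Fin d) => (1 : ℝ)) (g := Y) (v := EuclideanSpace.single i 1)
    (by simp) (by simpa [pderiv] using h1) (by simpa using hY.continuous.integrable_of_hasCompactSupport hc)
    (fun _ _ => differentiableAt_const _) (fun _ _ => hY.differentiable (by simp) _)
  simpa [pderiv] using h

theorem smoothOff_norm : SmoothOff fun x : EuclideanSpace ℝ (Fin d) => ‖x‖ :=
  fun _ hx => ((contDiffAt_norm ℝ hx).contDiffWithinAt)

/-- The weights of the two terms that arise from differentiating `radialBump (‖x‖ ^ 2) * F x` for a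
`0`-homogeneous function `F`. -/
theorem integral_pderiv_radialBump_mul [NeZero d] {F : EuclideanSpace ℝ (Fin d) → ℝ}
    (hF : SmoothOff F) (hhom : HomogeneousOff 0 F) (i : Fin d) :
    (∫ s : UnitSphere d, pderiv i F s ∂(sphereMeasure d)) *
        (∫ x : EuclideanSpace ℝ (Fin d), radialBump (‖x‖ ^ 2) * ‖x‖⁻¹) +
      (∫ s : UnitSphere d, s.1 i * F s ∂(sphereMeasure d)) *
        (∫ x : EuclideanSpace ℝ (Fin d), deriv radialBump (‖x‖ ^ 2) * (2 * ‖x‖)) = 0 := by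
  have hprod (x : EuclideanSpace ℝ (Fin d)) (hx : x ≠ 0) :
      pderiv i (fun x => radialBump (‖x‖ ^ 2) * F x) x =
        radialBump (‖x‖ ^ 2) * pderiv i F x +
          deriv radialBump (‖x‖ ^ 2) * (2 * x i) * F x := by
    have hb : Differentiable ℝ radialBump := radialBump.contDiff.differentiable one_ne_zero (n := 1)
    have hn : DifferentiableAt ℝ (fun x : EuclideanSpace ℝ (Fin d) => ‖x‖ ^ 2) x :=
      ((contDiff_norm_sq ℝ (n := 1)).differentiable one_ne_zero) x
    have h1 := pderiv_scomp (F := fun x : EuclideanSpace ℝ (Fin d) => ‖x‖ ^ 2) i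
      (hb (‖x‖ ^ 2)).hasDerivAt hn
    have h2 : pderiv i (fun x : EuclideanSpace ℝ (Fin d) => ‖x‖ ^ 2) x = 2 * x i := by
      simp only [pderiv]
      rw [fderiv_norm_sq_apply]
      simp [EuclideanSpace.inner_single_right]
    rw [pderiv_mul (F := fun x => radialBump (‖x‖ ^ 2)) i ((hb _).comp x hn) (hF.differentiableAt hx), h1, h2]
    ring
  have hI1 := integrable_radialBump_mul (hF.pderiv i)
  have hY := contDiff_radialBump_mul hF
  have hYc : HasCompactSupport fun x => radialBump (‖x‖ ^ 2) * F x :=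
    hasCompactSupport_radialBump.mul_right
  have hI : Integrable (fun x => pderiv i (fun x => radialBump (‖x‖ ^ 2) * F x) x) :=
    ((hY.continuous_fderiv (by simp)).clm_apply
      continuous_const).integrable_of_hasCompactSupport (hYc.fderiv_apply (𝕜 := ℝ) _)
  have h0 := integral_pderiv_eq_zero hY hYc i
  -- The second summand is kept as a difference, which gives its integrability directly; the product
  -- rule identifies it only off the origin, as polar coordinates require.
  have hsplit : ∫ x, pderiv i (fun x => radialBump (‖x‖ ^ 2) * F x) x =
      (∫ x, radialBump (‖x‖ ^ 2) * pderiv i F x) +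
      ∫ x, (pderiv i (fun x => radialBump (‖x‖ ^ 2) * F x) x -
        radialBump (‖x‖ ^ 2) * pderiv i F x) := by
    rw [← integral_add hI1 (by exact hI.sub hI1)]
    simp
  rw [hsplit, integral_polar (F := fun x => radialBump (‖x‖ ^ 2) * pderiv i F x) (g := fun s => pderiv i F s) (ρ := fun r => radialBump (r ^ 2) * r⁻¹)
      (fun s r hr => ?_),
    integral_polar (F := fun x => pderiv i (fun x => radialBump (‖x‖ ^ 2) * F x) x -
        radialBump (‖x‖ ^ 2) * pderiv i F x) (g := fun s => s.1 i * F s)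
      (ρ := fun r => deriv radialBump (r ^ 2) * (2 * r)) (fun s r hr => ?_)] at h0
  · exact h0
  · have hs := ne_zero_of_mem_unit_sphere s
    have hrs : r • (s : EuclideanSpace ℝ (Fin d)) ≠ 0 := smul_ne_zero hr.ne' hs
    rw [hprod _ hrs, hhom r hr _ hs, norm_smul, norm_eq_of_mem_sphere, mul_one,
      Real.norm_of_nonneg hr.le, zpow_zero]
    simp
    ring
  · rw [hhom.pderiv i r hr _ (ne_zero_of_mem_unit_sphere s), norm_smul, norm_eq_of_mem_sphere,
      mul_one, Real.norm_of_nonneg hr.le, zero_sub, zpow_neg_one]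
    ring

theorem integral_radialBump_inv_pos [NeZero d] :
    0 < ∫ x : EuclideanSpace ℝ (Fin d), radialBump (‖x‖ ^ 2) * ‖x‖⁻¹ := by
  have hs : SmoothOff fun x : EuclideanSpace ℝ (Fin d) => ‖x‖⁻¹ :=
    ContDiffOn.inv smoothOff_norm fun x hx => norm_ne_zero_iff.2 hx
  refine Continuous.integral_pos_of_hasCompactSupport_nonneg_nonzero
    -- The cutoff is centred at squared norm 2, hence norm √2.
    (x := EuclideanSpace.single 0 √2) (contDiff_radialBump_mul hs).continuous
    hasCompactSupport_radialBump.mul_right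
    (fun x => mul_nonneg radialBump.nonneg (by positivity)) ?_
  rw [PiLp.norm_single, Real.norm_of_nonneg (Real.sqrt_nonneg 2), Real.sq_sqrt zero_le_two,
    radialBump.one_of_mem_closedBall (by simp [radialBump])]
  positivity

end SphereIntegrals

/-! ### Integration by parts and the divergence theorem on the sphere. -/

section SphereIBP

open MeasureTheory
open scoped RealInnerProductSpace

variable {d : ℕ}

theorem contDiffOn_normalize :
    ContDiffOn ℝ ∞ (fun x : EuclideanSpace ℝ (Fin d) => ‖x‖⁻¹ • x) {0}ᶜ :=
  ContDiffOn.smul (ContDiffOn.inv smoothOff_norm fun _ hx => norm_ne_zero_iff.2 hx) contDiffOn_id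

theorem normalize_ne_zero {x : EuclideanSpace ℝ (Fin d)} (hx : x ≠ 0) : ‖x‖⁻¹ • x ≠ 0 :=
  smul_ne_zero (inv_ne_zero (norm_ne_zero_iff.2 hx)) hx

theorem fderiv_normalize_apply (s : UnitSphere d) (v : EuclideanSpace ℝ (Fin d)) :
    fderiv ℝ (fun x : EuclideanSpace ℝ (Fin d) => ‖x‖⁻¹ • x) s v = v - ⟪s.1, v⟫ • s.1 := by
  have hs : ‖s.1‖ = 1 := norm_eq_of_mem_sphere s
  have h1 := (hasStrictFDerivAt_norm_sq s.1).hasFDerivAt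
  have h2 : HasDerivAt (fun u : ℝ => (√u)⁻¹) (-(1 / (2 * √(‖s.1‖ ^ 2))) / √(‖s.1‖ ^ 2) ^ 2)
      (‖s.1‖ ^ 2) :=
    (Real.hasDerivAt_sqrt (by simp)).inv (by simp)
  have h3 := (h2.comp_hasFDerivAt s.1 h1).smul (hasFDerivAt_id s.1)
  have e : (fun x : EuclideanSpace ℝ (Fin d) => ‖x‖⁻¹ • x) =
      ((fun u : ℝ => (√u)⁻¹) ∘ fun x : EuclideanSpace ℝ (Fin d) => ‖x‖ ^ 2) • id := by
    funext x
    simp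
  rw [e, h3.fderiv]
  simp [hs, sub_eq_add_neg]

theorem pderiv_comp_normalize {F : EuclideanSpace ℝ (Fin d) → ℝ} (hF : SmoothOff F)
    (s : UnitSphere d) (i : Fin d) :
    pderiv i (fun x => F (‖x‖⁻¹ • x)) s =
      pderiv i F s - s.1 i * ∑ j, s.1 j * pderiv j F s := by
  have hs0 := ne_zero_of_mem_unit_sphere s
  have hN : DifferentiableAt ℝ (fun x : EuclideanSpace ℝ (Fin d) => ‖x‖⁻¹ • x) s :=
    (contDiffOn_normalize.contDiffAt (isOpen_compl_zero.mem_nhds hs0)).differentiableAt (by simp)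
  have hs : ‖s.1‖⁻¹ • s.1 = s.1 := by rw [norm_eq_of_mem_sphere s, inv_one, one_smul]
  have hF' : DifferentiableAt ℝ F (‖s.1‖⁻¹ • s.1) := by
    rw [hs]
    exact hF.differentiableAt hs0
  have h := fderiv_comp (f := fun x : EuclideanSpace ℝ (Fin d) => ‖x‖⁻¹ • x) s.1 hF' hN
  have h' := congrArg (fun L => L (EuclideanSpace.single i 1)) h
  simp only [ContinuousLinearMap.comp_apply, fderiv_normalize_apply, hs] at h'
  simp only [pderiv]
  rw [show (fun x : EuclideanSpace ℝ (Fin d) => F (‖x‖⁻¹ • x)) = F ∘ fun x => ‖x‖⁻¹ • x from rfl,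
    h', map_sub, map_smul, clm_apply_eq_sum _ s.1, smul_eq_mul, EuclideanSpace.inner_single_right]
  simp

theorem smoothOff_comp_normalize {F : EuclideanSpace ℝ (Fin d) → ℝ} (hF : SmoothOff F) :
    SmoothOff fun x => F (‖x‖⁻¹ • x) :=
  ContDiffOn.comp hF contDiffOn_normalize fun _ hx => normalize_ne_zero hx

theorem homogeneousOff_comp_normalize (F : EuclideanSpace ℝ (Fin d) → ℝ) :
    HomogeneousOff 0 fun x => F (‖x‖⁻¹ • x) := by
  intro r hr x hx
  beta_reduce
  rw [norm_smul, Real.norm_of_nonneg hr.le, smul_smul, zpow_zero, one_mul, mul_inv,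
    mul_right_comm, inv_mul_cancel₀ hr.ne', one_mul]

theorem sum_sq_coord (s : UnitSphere d) : ∑ i, s.1 i ^ 2 = 1 := by
  rw [← EuclideanSpace.real_norm_sq_eq, norm_eq_of_mem_sphere, one_pow]

/-- The ratio of the two radial weights does not depend on F, so it can be read off from a test
case: F = xᵢ/|x|, summed over i, where Σ(1 - sᵢ²) = d - 1 and Σsᵢ² = 1. -/
theorem integral_deriv_radialBump [NeZero d] :
    (∫ x : EuclideanSpace ℝ (Fin d), deriv radialBump (‖x‖ ^ 2) * (2 * ‖x‖)) =
      -((d : ℝ) - 1) * ∫ x : EuclideanSpace ℝ (Fin d), radialBump (‖x‖ ^ 2) * ‖x‖⁻¹ := by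
  set α := ∫ x : EuclideanSpace ℝ (Fin d), radialBump (‖x‖ ^ 2) * ‖x‖⁻¹
  set β := ∫ x : EuclideanSpace ℝ (Fin d), deriv radialBump (‖x‖ ^ 2) * (2 * ‖x‖)
  have h (i : Fin d) := integral_pderiv_radialBump_mul
    (smoothOff_comp_normalize (SmoothOff.coord i)) (homogeneousOff_comp_normalize fun x => x i) i
  have h1 (s : UnitSphere d) (i : Fin d) : pderiv i
      (fun x : EuclideanSpace ℝ (Fin d) => (‖x‖⁻¹ • x) i) s = 1 - s.1 i ^ 2 := by
    rw [pderiv_comp_normalize (SmoothOff.coord i)]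
    simp [pderiv_coord, sq]
  have h2 (s : UnitSphere d) (i : Fin d) : s.1 i * (‖s.1‖⁻¹ • s.1) i = s.1 i ^ 2 := by
    rw [norm_eq_of_mem_sphere, inv_one, one_smul, sq]
  have hi (i : Fin d) : Integrable (fun s : UnitSphere d => s.1 i ^ 2) (sphereMeasure d) :=
    SmoothOff.integrable (ContDiffOn.pow (SmoothOff.coord i) 2)
  simp only [h1, h2] at h
  have hsum := Finset.sum_congr rfl fun i (_ : i ∈ Finset.univ) => h i
  rw [Finset.sum_add_distrib, ← Finset.sum_mul, ← Finset.sum_mul,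
    ← integral_finsetSum (f := fun (i : Fin d) (s : UnitSphere d) => 1 - s.1 i ^ 2) _
      fun i _ => (integrable_const (1 : ℝ)).sub (hi i),
    ← integral_finsetSum _ fun i _ => hi i] at hsum
  simp only [Finset.sum_sub_distrib, sum_sq_coord] at hsum
  simp at hsum
  linarith

/-- **Integration by parts** on the sphere. -/
theorem integral_pderiv_sub_radial [NeZero d] {F : EuclideanSpace ℝ (Fin d) → ℝ}
    (hF : SmoothOff F) (i : Fin d) :
    ∫ s : UnitSphere d, (pderiv i F s - s.1 i * ∑ j, s.1 j * pderiv j F s) ∂(sphereMeasure d) =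
      ((d : ℝ) - 1) * ∫ s : UnitSphere d, s.1 i * F s ∂(sphereMeasure d) := by
  have h := integral_pderiv_radialBump_mul (smoothOff_comp_normalize hF)
    (homogeneousOff_comp_normalize F) i
  simp only [pderiv_comp_normalize hF, norm_eq_of_mem_sphere, inv_one, one_smul] at h
  rw [integral_deriv_radialBump] at h
  have hpos := integral_radialBump_inv_pos (d := d)
  refine mul_right_cancel₀ hpos.ne' ?_
  linear_combination h

/-- The **divergence theorem** on the sphere, for homogeneous vector fields of `ℝ^d`. -/
theorem integral_divergence_eq [NeZero d] {k : ℤ} {X : Fin d → EuclideanSpace ℝ (Fin d) → ℝ}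
    (hX : ∀ i, SmoothOff (X i)) (hhom : ∀ i, HomogeneousOff k (X i)) :
    ∫ s : UnitSphere d, ∑ i, pderiv i (X i) s ∂(sphereMeasure d) =
      ((d : ℝ) - 1 + k) * ∫ s : UnitSphere d, ∑ i, s.1 i * X i s ∂(sphereMeasure d) := by
  have h1 (i : Fin d) : Integrable (fun s : UnitSphere d => pderiv i (X i) s) (sphereMeasure d) :=
    ((hX i).pderiv i).integrable
  have h2 (i : Fin d) : Integrable (fun s : UnitSphere d => s.1 i * X i s) (sphereMeasure d) :=
    SmoothOff.integrable (ContDiffOn.mul (SmoothOff.coord i) (hX i))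
  rw [integral_finsetSum _ fun i _ => h1 i, integral_finsetSum _ fun i _ => h2 i, Finset.mul_sum]
  refine Finset.sum_congr rfl fun i _ => ?_
  have h := integral_pderiv_sub_radial (hX i) i
  have e (s : UnitSphere d) : pderiv i (X i) s - s.1 i * ∑ j, s.1 j * pderiv j (X i) s =
      pderiv i (X i) s - k * (s.1 i * X i s) := by
    rw [(hhom i).euler ((hX i).differentiableAt (ne_zero_of_mem_unit_sphere s))
      (ne_zero_of_mem_unit_sphere s)]
    ring
  simp only [e] at h
  rw [integral_sub (h1 i) ((h2 i).const_mul _), integral_const_mul] at h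
  linarith

end SphereIBP

/-! ### Hilbert–Schmidt norms and traces of tangential forms. -/

section MatrixAlgebra

variable {d : ℕ}

/-- Expansion of a Hilbert-Schmidt norm, for a symmetric form whose contraction with the unit vector
`s` is `-a`, where `a` is orthogonal to `s`. -/
theorem sum_sq_symmetric_form {s a : Fin d → ℝ} {Q : Fin d → Fin d → ℝ} (hs : ∑ i, s i ^ 2 = 1)
    (ha : ∑ i, s i * a i = 0) (hQ : ∀ j, ∑ i, s i * Q i j = -a j)
    (hsymm : ∀ i j, Q i j = Q j i) (α β γ : ℝ) :
    ∑ i, ∑ j, (Q i j + α * (s i * a j + a i * s j) + β * (a i * a j) +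
        γ * (if i = j then 1 else 0)) ^ 2 =
      ∑ i, ∑ j, Q i j ^ 2 + (2 * α ^ 2 - 4 * α + 2 * β * γ) * ∑ i, a i ^ 2 +
        β ^ 2 * (∑ i, a i ^ 2) ^ 2 + γ ^ 2 * d + 2 * β * ∑ i, ∑ j, a i * Q i j * a j +
        2 * γ * ∑ i, Q i i := by
  have e1 : ∑ i, ∑ j, s i * Q i j * a j = -∑ i, a i ^ 2 := by
    rw [Finset.sum_comm, ← Finset.sum_neg_distrib]
    refine Finset.sum_congr rfl fun j _ => ?_
    rw [← Finset.sum_mul, hQ]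
    ring
  have e2 : ∑ i, ∑ j, a i * Q i j * s j = -∑ i, a i ^ 2 := by
    rw [← Finset.sum_neg_distrib]
    refine Finset.sum_congr rfl fun i _ => ?_
    have := hQ i
    calc ∑ j, a i * Q i j * s j = a i * ∑ j, s j * Q j i := by
          rw [Finset.mul_sum]
          exact Finset.sum_congr rfl fun j _ => by rw [hsymm i j]; ring
      _ = -a i ^ 2 := by rw [hQ]; ring
  have e9 : ∑ i : Fin d, ∑ j : Fin d, (if i = j then (1 : ℝ) else 0) = d := by simp
  have e10 : ∑ i, ∑ j, (if i = j then (1 : ℝ) else 0) * (s i * a j) = 0 := by simpa using ha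
  have e11 : ∑ i, ∑ j, (if i = j then (1 : ℝ) else 0) * (a i * a j) = ∑ i, a i ^ 2 := by
    simp [sq]
  have e12 : ∑ i, ∑ j, (if i = j then (1 : ℝ) else 0) * Q i j = ∑ i, Q i i := by simp
  have e13 : ∑ i, ∑ j, (if i = j then (1 : ℝ) else 0) * (a i * s j) = 0 := by
    simpa [mul_comm] using ha
  have key (i j : Fin d) : (Q i j + α * (s i * a j + a i * s j) + β * (a i * a j) +
        γ * (if i = j then 1 else 0)) ^ 2 =
      Q i j ^ 2 + 2 * α * (s i * Q i j * a j) + 2 * α * (a i * Q i j * s j) +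
      α ^ 2 * (s i ^ 2 * a j ^ 2) + 2 * α ^ 2 * (s i * a i * (s j * a j)) +
      α ^ 2 * (a i ^ 2 * s j ^ 2) + 2 * α * β * (s i * a i * a j ^ 2) +
      2 * α * β * (a i ^ 2 * (s j * a j)) + β ^ 2 * (a i ^ 2 * a j ^ 2) +
      γ ^ 2 * (if i = j then 1 else 0) +
      2 * α * γ * ((if i = j then 1 else 0) * (s i * a j)) +
      2 * α * γ * ((if i = j then 1 else 0) * (a i * s j)) +
      2 * β * γ * ((if i = j then 1 else 0) * (a i * a j)) +
      2 * γ * ((if i = j then 1 else 0) * Q i j) + 2 * β * (a i * Q i j * a j) := by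
    split_ifs <;> ring
  simp only [key, Finset.sum_add_distrib, ← Finset.mul_sum]
  rw [e1, e2, e9, e10, e11, e12, e13]
  simp only [← Finset.sum_mul, hs, ha]
  ring

/-- The trace inequality for a form on `s^⊥`, which has dimension `d - 1`. -/
theorem sq_trace_le {s : Fin d → ℝ} {T : Fin d → Fin d → ℝ} (hs : ∑ i, s i ^ 2 = 1)
    (hT : ∑ i, ∑ j, s i * s j * T i j = 0) :
    (∑ i, T i i) ^ 2 ≤ ((d : ℝ) - 1) * ∑ i, ∑ j, T i j ^ 2 := by
  -- Cauchy–Schwarz against the projection I - s⊗s onto the tangent space, whose squared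
  -- Hilbert–Schmidt norm is d - 1 instead of d.
  have h := Finset.sum_mul_sq_le_sq_mul_sq Finset.univ
    (fun p : Fin d × Fin d => (if p.1 = p.2 then (1 : ℝ) else 0) - s p.1 * s p.2)
    (fun p => T p.1 p.2)
  simp only [Fintype.sum_prod_type] at h
  have h1 : ∑ i, ∑ j, ((if i = j then (1 : ℝ) else 0) - s i * s j) * T i j = ∑ i, T i i := by
    simp [sub_mul, Finset.sum_sub_distrib, hT]
  have h2 : ∑ i, ∑ j, ((if i = j then (1 : ℝ) else 0) - s i * s j) ^ 2 = (d : ℝ) - 1 := by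
    have e (i j : Fin d) : ((if i = j then (1 : ℝ) else 0) - s i * s j) ^ 2 =
        (if i = j then (1 : ℝ) else 0) * (1 - 2 * (s i * s j)) + s i ^ 2 * s j ^ 2 := by
      split_ifs <;> ring
    simp only [e, Finset.sum_add_distrib]
    rw [← Finset.sum_mul_sum, hs]
    simp [Finset.sum_sub_distrib, ← Finset.mul_sum, ← sq, hs]
    ring
  rwa [h1, h2] at h

end MatrixAlgebra

/-! ### Integral identities from the divergence theorem. -/

section IntegralIdentities

open MeasureTheory

variable {d : ℕ}

namespace HomogeneousOff

variable {k l : ℤ} {F G : EuclideanSpace ℝ (Fin d) → ℝ}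

theorem mul (hF : HomogeneousOff k F) (hG : HomogeneousOff l G) :
    HomogeneousOff (k + l) fun x => F x * G x := by
  intro r hr x hx
  beta_reduce
  rw [hF r hr x hx, hG r hr x hx, zpow_add₀ hr.ne']
  ring

theorem sub (hF : HomogeneousOff k F) (hG : HomogeneousOff k G) :
    HomogeneousOff k fun x => F x - G x := by
  intro r hr x hx
  beta_reduce
  rw [hF r hr x hx, hG r hr x hx]
  ring

theorem sum {ι : Type*} {u : Finset ι} {F : ι → EuclideanSpace ℝ (Fin d) → ℝ}
    (hF : ∀ i ∈ u, HomogeneousOff k (F i)) : HomogeneousOff k fun x => ∑ i ∈ u, F i x := by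
  intro r hr x hx
  beta_reduce
  rw [Finset.mul_sum]
  exact Finset.sum_congr rfl fun i hi => hF i hi r hr x hx

theorem inv (hF : HomogeneousOff 0 F) : HomogeneousOff 0 fun x => (F x)⁻¹ := by
  intro r hr x hx
  beta_reduce
  rw [hF r hr x hx, zpow_zero, one_mul, one_mul]

theorem coord (i : Fin d) : HomogeneousOff 1 fun x : EuclideanSpace ℝ (Fin d) => x i := by
  intro r _ x _
  simp

end HomogeneousOff

variable {H : EuclideanSpace ℝ (Fin d) → ℝ}

theorem sum_coord_mul_pderiv (hH : SmoothOff H) (h0 : HomogeneousOff 0 H) (s : UnitSphere d) :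
    ∑ i, s.1 i * pderiv i H s = 0 := by
  rw [h0.euler (hH.differentiableAt (ne_zero_of_mem_unit_sphere s)) (ne_zero_of_mem_unit_sphere s)]
  simp

/-- Euler's identity for ∂ⱼH, of degree -1. The Euclidean Hessian of the extension therefore has a
mixed radial-tangential part, and its squared norm exceeds that of the spherical Hessian by 2|∇h|².
-/
theorem sum_coord_mul_pderiv_pderiv (hH : SmoothOff H) (h0 : HomogeneousOff 0 H) (s : UnitSphere d)
    (j : Fin d) : ∑ i, s.1 i * pderiv i (pderiv j H) s = -pderiv j H s := by
  rw [(h0.pderiv j).euler ((hH.pderiv j).differentiableAt (ne_zero_of_mem_unit_sphere s))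
    (ne_zero_of_mem_unit_sphere s)]
  simp

/-- The integrated **Bochner formula**. -/
theorem integral_bochner [NeZero d] (hH : SmoothOff H) (h0 : HomogeneousOff 0 H) :
    ∫ s : UnitSphere d, (∑ i, pderiv i (pderiv i H) s) ^ 2 ∂(sphereMeasure d) =
      (∫ s : UnitSphere d, ∑ i, ∑ j, pderiv i (pderiv j H) s ^ 2 ∂(sphereMeasure d)) +
      ((d : ℝ) - 4) * ∫ s : UnitSphere d, ∑ i, pderiv i H s ^ 2 ∂(sphereMeasure d) := by
  have hs2 (i j : Fin d) : SmoothOff (pderiv i (pderiv j H)) := (hH.pderiv j).pderiv i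
  have hterm (i j : Fin d) : SmoothOff fun x => pderiv j (pderiv j H) x * pderiv i H x -
      pderiv j (pderiv i H) x * pderiv j H x :=
    ContDiffOn.sub (ContDiffOn.mul (hs2 j j) (hH.pderiv i)) (ContDiffOn.mul (hs2 j i) (hH.pderiv j))
  -- The field is ΔH ∇H - D²H ∇H. Its third-order terms cancel in the divergence, its radial
  -- component is |∇H|², and degree -3 turns d - 1 into d - 4.
  have h := integral_divergence_eq (k := -3) (X := fun i x => ∑ j,
      (pderiv j (pderiv j H) x * pderiv i H x - pderiv j (pderiv i H) x * pderiv j H x))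
    (fun i => ContDiffOn.sum fun j _ => hterm i j)
    (fun i => HomogeneousOff.sum fun j _ =>
      (((h0.pderiv j).pderiv j).mul (h0.pderiv i)).sub (((h0.pderiv i).pderiv j).mul (h0.pderiv j)))
  have hdiv (s : UnitSphere d) : ∑ i, pderiv i (fun x => ∑ j,
      (pderiv j (pderiv j H) x * pderiv i H x - pderiv j (pderiv i H) x * pderiv j H x)) s =
      (∑ i, pderiv i (pderiv i H) s) ^ 2 - ∑ i, ∑ j, pderiv i (pderiv j H) s ^ 2 := by
    have hs := ne_zero_of_mem_unit_sphere s
    have e (i j : Fin d) : pderiv i (fun x => pderiv j (pderiv j H) x * pderiv i H x -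
        pderiv j (pderiv i H) x * pderiv j H x) s =
        pderiv i (pderiv j (pderiv j H)) s * pderiv i H s -
          pderiv j (pderiv i (pderiv i H)) s * pderiv j H s +
        (pderiv i (pderiv i H) s * pderiv j (pderiv j H) s - pderiv i (pderiv j H) s ^ 2) := by
      rw [pderiv_sub (F := fun x => pderiv j (pderiv j H) x * pderiv i H x)
          (G := fun x => pderiv j (pderiv i H) x * pderiv j H x) i
        (((hs2 j j).differentiableAt hs).mul ((hH.pderiv i).differentiableAt hs))
        (((hs2 j i).differentiableAt hs).mul ((hH.pderiv j).differentiableAt hs)),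
        pderiv_mul i ((hs2 j j).differentiableAt hs) ((hH.pderiv i).differentiableAt hs),
        pderiv_mul i ((hs2 j i).differentiableAt hs) ((hH.pderiv j).differentiableAt hs),
        pderiv_comm (hH.pderiv i) hs i j, pderiv_comm hH hs j i]
      ring
    have e' (i : Fin d) := pderiv_sum i Finset.univ
      fun j _ => (hterm i j).differentiableAt hs
    simp only [e']
    simp only [e, Finset.sum_add_distrib, Finset.sum_sub_distrib]
    rw [Finset.sum_comm (f := fun i j => pderiv j (pderiv i (pderiv i H)) s * pderiv j H s),
      ← Finset.sum_mul_sum]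
    ring
  have hrad (s : UnitSphere d) : ∑ i, s.1 i * ∑ j,
      (pderiv j (pderiv j H) s * pderiv i H s - pderiv j (pderiv i H) s * pderiv j H s) =
      ∑ i, pderiv i H s ^ 2 := by
    have hs := ne_zero_of_mem_unit_sphere s
    have e (i j : Fin d) : s.1 i * (pderiv j (pderiv j H) s * pderiv i H s -
        pderiv j (pderiv i H) s * pderiv j H s) =
        s.1 i * pderiv i H s * pderiv j (pderiv j H) s -
          s.1 i * pderiv i (pderiv j H) s * pderiv j H s := by
      rw [pderiv_comm hH hs j i]
      ring
    simp only [Finset.mul_sum]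
    simp only [e, Finset.sum_sub_distrib]
    rw [← Finset.sum_mul_sum, sum_coord_mul_pderiv hH h0, Finset.sum_comm]
    simp only [← Finset.sum_mul, sum_coord_mul_pderiv_pderiv hH h0]
    rw [zero_mul, zero_sub, ← Finset.sum_neg_distrib]
    exact Finset.sum_congr rfl fun i _ => by ring
  simp only [hdiv, hrad] at h
  rw [integral_sub] at h
  · push_cast at h
    linarith
  · exact SmoothOff.integrable (F := fun x => (∑ i, pderiv i (pderiv i H) x) ^ 2)
      (ContDiffOn.pow (ContDiffOn.sum fun i _ => hs2 i i) 2)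
  · exact SmoothOff.integrable (F := fun x => ∑ i, ∑ j, pderiv i (pderiv j H) x ^ 2)
      (ContDiffOn.sum fun i _ => ContDiffOn.sum fun j _ => ContDiffOn.pow (hs2 i j) 2)

/-- The field H∇H is tangential, so its divergence integrates to zero. -/
theorem integral_mul_laplacian [NeZero d] (hH : SmoothOff H) (h0 : HomogeneousOff 0 H) :
    ∫ s : UnitSphere d, H s * ∑ i, pderiv i (pderiv i H) s ∂(sphereMeasure d) =
      -∫ s : UnitSphere d, ∑ i, pderiv i H s ^ 2 ∂(sphereMeasure d) := by
  have h := integral_divergence_eq (k := -1) (X := fun i x => H x * pderiv i H x)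
    (fun i => ContDiffOn.mul hH (hH.pderiv i)) (fun i => h0.mul (h0.pderiv i))
  have hdiv (s : UnitSphere d) : ∑ i, pderiv i (fun x => H x * pderiv i H x) s =
      H s * ∑ i, pderiv i (pderiv i H) s + ∑ i, pderiv i H s ^ 2 := by
    have hs := ne_zero_of_mem_unit_sphere s
    rw [Finset.mul_sum, ← Finset.sum_add_distrib]
    refine Finset.sum_congr rfl fun i _ => ?_
    rw [pderiv_mul i (hH.differentiableAt hs) ((hH.pderiv i).differentiableAt hs)]
    ring
  have hrad (s : UnitSphere d) : ∑ i, s.1 i * (H s * pderiv i H s) = 0 := by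
    have := sum_coord_mul_pderiv hH h0 s
    simp only [mul_left_comm _ (H s), ← Finset.mul_sum, this, mul_zero]
  simp only [hdiv, hrad] at h
  rw [integral_add] at h
  · simp only [integral_zero, mul_zero] at h
    linarith
  · exact SmoothOff.integrable (F := fun x => H x * ∑ i, pderiv i (pderiv i H) x)
      (ContDiffOn.mul hH (ContDiffOn.sum fun i _ => (hH.pderiv i).pderiv i))
  · exact SmoothOff.integrable (F := fun x => ∑ i, pderiv i H x ^ 2)
      (ContDiffOn.sum fun i _ => ContDiffOn.pow (hH.pderiv i) 2)

/-- The divergence of the tangential field H⁻¹|∇H|²∇H integrates to zero. This removes the Hessian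
term contracted with two gradients in favour of B and D. -/
theorem integral_hessian_gradient_gradient [NeZero d] (hH : SmoothOff H) (h0 : HomogeneousOff 0 H)
    (hpos : ∀ x, 0 < H x) :
    2 * ∫ s : UnitSphere d, (H s)⁻¹ *
        ∑ i, ∑ j, pderiv i H s * pderiv i (pderiv j H) s * pderiv j H s ∂(sphereMeasure d) =
      (∫ s : UnitSphere d, ((H s)⁻¹ * ∑ i, pderiv i H s ^ 2) ^ 2 ∂(sphereMeasure d)) -
      ∫ s : UnitSphere d, (H s)⁻¹ * (∑ i, pderiv i H s ^ 2) *
        ∑ i, pderiv i (pderiv i H) s ∂(sphereMeasure d) := by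
  have hN : SmoothOff fun x => ∑ j, pderiv j H x ^ 2 :=
    ContDiffOn.sum fun i _ => ContDiffOn.pow (hH.pderiv i) 2
  have hI : SmoothOff fun x => (H x)⁻¹ := ContDiffOn.inv hH fun x _ => (hpos x).ne'
  have hIN : SmoothOff fun x => (H x)⁻¹ * ∑ j, pderiv j H x ^ 2 := ContDiffOn.mul hI hN
  have hNhom : HomogeneousOff (-2) fun x => ∑ j, pderiv j H x ^ 2 := by
    simp only [sq]
    exact HomogeneousOff.sum fun j _ => (h0.pderiv j).mul (h0.pderiv j)
  have h := integral_divergence_eq (k := -3)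
    (X := fun i x => (H x)⁻¹ * (∑ j, pderiv j H x ^ 2) * pderiv i H x)
    (fun i => ContDiffOn.mul hIN (hH.pderiv i)) (fun i => (h0.inv.mul hNhom).mul (h0.pderiv i))
  have hdiv (s : UnitSphere d) :
      ∑ i, pderiv i (fun x => (H x)⁻¹ * (∑ j, pderiv j H x ^ 2) * pderiv i H x) s =
      2 * ((H s)⁻¹ * ∑ i, ∑ j, pderiv i H s * pderiv i (pderiv j H) s * pderiv j H s) -
      ((H s)⁻¹ * ∑ i, pderiv i H s ^ 2) ^ 2 +
      (H s)⁻¹ * (∑ i, pderiv i H s ^ 2) * ∑ i, pderiv i (pderiv i H) s := by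
    have hs := ne_zero_of_mem_unit_sphere s
    have e (i : Fin d) : pderiv i (fun x => (H x)⁻¹ * (∑ j, pderiv j H x ^ 2) * pderiv i H x) s =
        2 * ((H s)⁻¹ * ∑ j, pderiv i H s * pderiv i (pderiv j H) s * pderiv j H s) -
        (H s)⁻¹ ^ 2 * (∑ j, pderiv j H s ^ 2) * pderiv i H s ^ 2 +
        (H s)⁻¹ * (∑ j, pderiv j H s ^ 2) * pderiv i (pderiv i H) s := by
      rw [pderiv_mul i (hIN.differentiableAt hs) ((hH.pderiv i).differentiableAt hs),
        pderiv_mul i (hI.differentiableAt hs) (hN.differentiableAt hs),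
        pderiv_sum (F := fun j x => pderiv j H x ^ 2) i Finset.univ
          fun j _ => ((hH.pderiv j).differentiableAt hs).pow 2,
        pderiv_scomp i (hasDerivAt_inv (hpos s).ne') (hH.differentiableAt hs)]
      have e2 (j : Fin d) : pderiv i (fun y => pderiv j H y ^ 2) s =
          2 * pderiv j H s * pderiv i (pderiv j H) s := by
        rw [pderiv_scomp i (φ := fun t => t ^ 2) (by simpa using hasDerivAt_pow 2 (pderiv j H s))
          ((hH.pderiv j).differentiableAt hs)]
      simp only [e2, mul_assoc (2 : ℝ), ← Finset.mul_sum]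
      have e3 : ∑ j, pderiv i H s * pderiv i (pderiv j H) s * pderiv j H s =
          pderiv i H s * ∑ j, pderiv j H s * pderiv i (pderiv j H) s := by
        rw [Finset.mul_sum]
        exact Finset.sum_congr rfl fun j _ => by ring
      rw [e3]
      ring
    simp only [e, Finset.sum_add_distrib, Finset.sum_sub_distrib, ← Finset.mul_sum]
    ring
  have hrad (s : UnitSphere d) :
      ∑ i, s.1 i * ((H s)⁻¹ * (∑ j, pderiv j H s ^ 2) * pderiv i H s) = 0 := by
    have := sum_coord_mul_pderiv hH h0 s
    simp only [mul_left_comm (s.1 _), ← Finset.mul_sum, this, mul_zero]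
  simp only [hdiv, hrad] at h
  have i1 : Integrable (fun s : UnitSphere d => 2 * ((H s)⁻¹ *
      ∑ i, ∑ j, pderiv i H s * pderiv i (pderiv j H) s * pderiv j H s)) (sphereMeasure d) :=
    SmoothOff.integrable (F := fun x => 2 * ((H x)⁻¹ *
      ∑ i, ∑ j, pderiv i H x * pderiv i (pderiv j H) x * pderiv j H x))
      (ContDiffOn.mul contDiffOn_const (ContDiffOn.mul hI (ContDiffOn.sum fun i _ =>
        ContDiffOn.sum fun j _ => ContDiffOn.mul (ContDiffOn.mul (hH.pderiv i)
          ((hH.pderiv j).pderiv i)) (hH.pderiv j))))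
  have i2 : Integrable (fun s : UnitSphere d => ((H s)⁻¹ * ∑ i, pderiv i H s ^ 2) ^ 2)
      (sphereMeasure d) :=
    SmoothOff.integrable (F := fun x => ((H x)⁻¹ * ∑ i, pderiv i H x ^ 2) ^ 2)
      (ContDiffOn.pow hIN 2)
  have i3 : Integrable (fun s : UnitSphere d => (H s)⁻¹ * (∑ i, pderiv i H s ^ 2) *
      ∑ i, pderiv i (pderiv i H) s) (sphereMeasure d) :=
    SmoothOff.integrable (F := fun x => (H x)⁻¹ * (∑ i, pderiv i H x ^ 2) *
      ∑ i, pderiv i (pderiv i H) x)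
      (ContDiffOn.mul hIN (ContDiffOn.sum fun i _ => (hH.pderiv i).pderiv i))
  have i12 := i1.sub i2
  simp only [Pi.sub_def] at i12
  rw [integral_add i12 i3, integral_sub i1 i2, integral_const_mul] at h
  simp only [integral_zero, mul_zero] at h
  linarith

end IntegralIdentities

/-! ### The spectral gap for even functions and the integrated trace inequality. -/

section EvenPoincare

open MeasureTheory

variable {d : ℕ} {H : EuclideanSpace ℝ (Fin d) → ℝ}

theorem pderiv_neg_of_even (heven : ∀ x, H (-x) = H x) (i : Fin d)
    (x : EuclideanSpace ℝ (Fin d)) : pderiv i H (-x) = -pderiv i H x := by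
  have h : (fun y => H ((-1 : ℝ) • y)) = H := funext fun y => by rw [neg_one_smul, heven]
  have h2 := fderiv_comp_smul (f := H) (x := x) (-1 : ℝ)
  rw [h, neg_one_smul, neg_one_smul] at h2
  simp only [pderiv, h2]
  simp

/-- The spectral gap of the sphere for even functions, in its second order form: the first non-zero
eigenvalue is `2 d`. -/
theorem sphere_poincare_even [NeZero d] (hd : 2 ≤ d) (hH : SmoothOff H) (h0 : HomogeneousOff 0 H)
    (heven : ∀ x, H (-x) = H x) :
    2 * (d : ℝ) * ∫ s : UnitSphere d, ∑ i, pderiv i H s ^ 2 ∂(sphereMeasure d) ≤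
      ∫ s : UnitSphere d, (∑ i, pderiv i (pderiv i H) s) ^ 2 ∂(sphereMeasure d) := by
  have hq : SmoothOff fun x : EuclideanSpace ℝ (Fin d) => ∑ j, x j * x j :=
    ContDiffOn.sum fun j _ => ContDiffOn.mul (SmoothOff.coord j) (SmoothOff.coord j)
  have hqhom : HomogeneousOff 2 fun x : EuclideanSpace ℝ (Fin d) => ∑ j, x j * x j :=
    HomogeneousOff.sum fun j _ => (HomogeneousOff.coord j).mul (HomogeneousOff.coord j)
  -- Multiplying by |x|² raises the degree to 2, so the partial derivatives are odd of degree 1, as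
  -- the odd Poincaré inequality needs.
  set K : EuclideanSpace ℝ (Fin d) → ℝ := fun x => (∑ j, x j * x j) * H x with hK
  have hKs : SmoothOff K := ContDiffOn.mul hq hH
  have hKhom : HomogeneousOff 2 K := hqhom.mul h0
  have hKeven : ∀ x, K (-x) = K x := fun x => by simp [hK, heven]
  have dq (i : Fin d) {x : EuclideanSpace ℝ (Fin d)} (hx : x ≠ 0) :
      pderiv i (fun x => ∑ j, x j * x j) x = 2 * x i := by
    rw [pderiv_sum (F := fun j x => x j * x j) i Finset.univ
      fun j _ => ((SmoothOff.coord j).differentiableAt hx).mul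
      ((SmoothOff.coord j).differentiableAt hx)]
    have e (j : Fin d) : pderiv i (fun y => y j * y j) x = if i = j then 2 * x j else 0 := by
      rw [pderiv_mul i ((SmoothOff.coord j).differentiableAt hx)
        ((SmoothOff.coord j).differentiableAt hx), pderiv_coord]
      split_ifs <;> ring
    simp only [e]
    simp
  have dK (i : Fin d) {x : EuclideanSpace ℝ (Fin d)} (hx : x ≠ 0) :
      pderiv i K x = 2 * x i * H x + (∑ j, x j * x j) * pderiv i H x := by
    rw [hK, pderiv_mul i (hq.differentiableAt hx) (hH.differentiableAt hx), dq i hx]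
  have hss (s : UnitSphere d) : ∑ j, s.1 j * s.1 j = 1 := by
    simpa [sq] using sum_sq_coord s
  have ddK (i j : Fin d) (s : UnitSphere d) : pderiv i (pderiv j K) s =
      pderiv i (pderiv j H) s + 2 * (s.1 i * pderiv j H s + pderiv i H s * s.1 j) +
        0 * (pderiv i H s * pderiv j H s) + 2 * H s * (if i = j then 1 else 0) := by
    have hs := ne_zero_of_mem_unit_sphere s
    have hc : SmoothOff fun x : EuclideanSpace ℝ (Fin d) => 2 * x j :=
      ContDiffOn.mul contDiffOn_const (SmoothOff.coord j)
    have h2 : pderiv i (fun x : EuclideanSpace ℝ (Fin d) => 2 * x j) s =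
        2 * if i = j then 1 else 0 := by
      rw [pderiv_scomp (F := fun x : EuclideanSpace ℝ (Fin d) => x j) i (φ := fun t => 2 * t)
        (by simpa using (hasDerivAt_id (s.1 j)).const_mul (2 : ℝ))
        ((SmoothOff.coord j).differentiableAt hs), pderiv_coord]
    rw [pderiv_congr i (fun y hy => dK j hy) hs,
      pderiv_add (F := fun x => 2 * x j * H x) (G := fun x => (∑ j, x j * x j) * pderiv j H x) i
        ((hc.differentiableAt hs).mul (hH.differentiableAt hs))
        ((hq.differentiableAt hs).mul ((hH.pderiv j).differentiableAt hs)),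
      pderiv_mul i (hc.differentiableAt hs) (hH.differentiableAt hs),
      pderiv_mul i (hq.differentiableAt hs) ((hH.pderiv j).differentiableAt hs),
      dq i hs, h2, hss]
    ring
  have hW (j : Fin d) := sphere_poincare_odd hd (hKs.pderiv j) (pderiv_neg_of_even hKeven j)
    (by simpa using hKhom.pderiv j)
  have hsum := Finset.sum_le_sum fun j (_ : j ∈ Finset.univ) => hW j
  have hWs (j : Fin d) : SmoothOff fun x => pderiv j K x ^ 2 := ContDiffOn.pow (hKs.pderiv j) 2
  have hDs (j : Fin d) : SmoothOff fun x => ∑ i, pderiv i (pderiv j K) x ^ 2 :=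
    ContDiffOn.sum fun i _ => ContDiffOn.pow ((hKs.pderiv j).pderiv i) 2
  rw [← Finset.mul_sum, ← integral_finsetSum _ fun j _ => (hWs j).integrable,
    ← integral_finsetSum _ fun j _ => (hDs j).integrable] at hsum
  have eW (s : UnitSphere d) : ∑ j, pderiv j K s ^ 2 =
      4 * H s ^ 2 + ∑ j, pderiv j H s ^ 2 := by
    have e (j : Fin d) : pderiv j K s ^ 2 = 4 * H s ^ 2 * s.1 j ^ 2 +
        4 * H s * (s.1 j * pderiv j H s) + pderiv j H s ^ 2 := by
      rw [dK j (ne_zero_of_mem_unit_sphere s), hss]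
      ring
    simp only [e, Finset.sum_add_distrib, ← Finset.mul_sum]
    rw [sum_sq_coord, sum_coord_mul_pderiv hH h0]
    ring
  have eD (s : UnitSphere d) : ∑ j, ∑ i, pderiv i (pderiv j K) s ^ 2 =
      ∑ i, ∑ j, pderiv i (pderiv j H) s ^ 2 + 4 * d * H s ^ 2 +
        4 * (H s * ∑ i, pderiv i (pderiv i H) s) := by
    rw [Finset.sum_comm]
    simp only [ddK]
    -- With α = 2, β = 0, γ = 2H, the coefficient 2α² - 4α + 2βγ of |∇H|² is zero.
    rw [sum_sq_symmetric_form (sum_sq_coord s) (sum_coord_mul_pderiv hH h0 s)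
      (sum_coord_mul_pderiv_pderiv hH h0 s)
      (fun i j => pderiv_comm hH (ne_zero_of_mem_unit_sphere s) i j)]
    ring
  simp only [eW, eD] at hsum
  have i1 : Integrable (fun s : UnitSphere d => H s ^ 2) (sphereMeasure d) :=
    SmoothOff.integrable (ContDiffOn.pow hH 2)
  have i2 : Integrable (fun s : UnitSphere d => ∑ j, pderiv j H s ^ 2) (sphereMeasure d) :=
    SmoothOff.integrable (F := fun x => ∑ j, pderiv j H x ^ 2)
      (ContDiffOn.sum fun i _ => ContDiffOn.pow (hH.pderiv i) 2)
  have i3 : Integrable (fun s : UnitSphere d => ∑ i, ∑ j, pderiv i (pderiv j H) s ^ 2)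
      (sphereMeasure d) :=
    SmoothOff.integrable (F := fun x => ∑ i, ∑ j, pderiv i (pderiv j H) x ^ 2)
      (ContDiffOn.sum fun i _ => ContDiffOn.sum fun j _ => ContDiffOn.pow ((hH.pderiv j).pderiv i) 2)
  have i4 : Integrable (fun s : UnitSphere d => H s * ∑ i, pderiv i (pderiv i H) s)
      (sphereMeasure d) :=
    SmoothOff.integrable (F := fun x => H x * ∑ i, pderiv i (pderiv i H) x)
      (ContDiffOn.mul hH (ContDiffOn.sum fun i _ => (hH.pderiv i).pderiv i))
  rw [integral_add (i1.const_mul 4) i2, integral_add (by exact i3.add (i1.const_mul _))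
    (i4.const_mul 4), integral_add i3 (i1.const_mul _), integral_const_mul, integral_const_mul,
    integral_const_mul, integral_mul_laplacian hH h0] at hsum
  -- The terms 4d∫H² cancel, leaving (d + 4)∫|∇H|² ≤ ∫‖D²H‖²; Bochner adds d - 4, which gives 2d.
  rw [integral_bochner hH h0]
  linarith

/-- The consequence of the trace inequality for the forms `∇² h + c h⁻¹ ∇h ⊗ ∇h`. -/
theorem integral_sq_laplacian_add_le [NeZero d] (hH : SmoothOff H) (h0 : HomogeneousOff 0 H)
    (hpos : ∀ x, 0 < H x) (c : ℝ) :
    (∫ s : UnitSphere d, (∑ i, pderiv i (pderiv i H) s) ^ 2 ∂(sphereMeasure d)) +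
        2 * c * (∫ s : UnitSphere d, (H s)⁻¹ * (∑ i, pderiv i H s ^ 2) *
          ∑ i, pderiv i (pderiv i H) s ∂(sphereMeasure d)) +
        c ^ 2 * ∫ s : UnitSphere d, ((H s)⁻¹ * ∑ i, pderiv i H s ^ 2) ^ 2 ∂(sphereMeasure d) ≤
      ((d : ℝ) - 1) *
        ((∫ s : UnitSphere d, ∑ i, ∑ j, pderiv i (pderiv j H) s ^ 2 ∂(sphereMeasure d)) -
          2 * (∫ s : UnitSphere d, ∑ i, pderiv i H s ^ 2 ∂(sphereMeasure d)) +
          2 * c * (∫ s : UnitSphere d, (H s)⁻¹ *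
            ∑ i, ∑ j, pderiv i H s * pderiv i (pderiv j H) s * pderiv j H s ∂(sphereMeasure d)) +
          c ^ 2 * ∫ s : UnitSphere d, ((H s)⁻¹ * ∑ i, pderiv i H s ^ 2) ^ 2 ∂(sphereMeasure d)) := by
  have hN : SmoothOff fun x => ∑ j, pderiv j H x ^ 2 :=
    ContDiffOn.sum fun i _ => ContDiffOn.pow (hH.pderiv i) 2
  have hI : SmoothOff fun x => (H x)⁻¹ := ContDiffOn.inv hH fun x _ => (hpos x).ne'
  have hL : SmoothOff fun x => ∑ i, pderiv i (pderiv i H) x :=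
    ContDiffOn.sum fun i _ => (hH.pderiv i).pderiv i
  have i1 : Integrable (fun s : UnitSphere d => (∑ i, pderiv i (pderiv i H) s) ^ 2)
      (sphereMeasure d) := SmoothOff.integrable (ContDiffOn.pow hL 2)
  have i2 : Integrable (fun s : UnitSphere d => (H s)⁻¹ * (∑ i, pderiv i H s ^ 2) *
      ∑ i, pderiv i (pderiv i H) s) (sphereMeasure d) :=
    SmoothOff.integrable (ContDiffOn.mul (ContDiffOn.mul hI hN) hL)
  have i3 : Integrable (fun s : UnitSphere d => ((H s)⁻¹ * ∑ i, pderiv i H s ^ 2) ^ 2)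
      (sphereMeasure d) := SmoothOff.integrable (ContDiffOn.pow (ContDiffOn.mul hI hN) 2)
  have i4 : Integrable (fun s : UnitSphere d => ∑ i, ∑ j, pderiv i (pderiv j H) s ^ 2)
      (sphereMeasure d) :=
    SmoothOff.integrable (F := fun x => ∑ i, ∑ j, pderiv i (pderiv j H) x ^ 2)
      (ContDiffOn.sum fun i _ => ContDiffOn.sum fun j _ => ContDiffOn.pow ((hH.pderiv j).pderiv i) 2)
  have i5 : Integrable (fun s : UnitSphere d => ∑ i, pderiv i H s ^ 2) (sphereMeasure d) :=
    hN.integrable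
  have i6 : Integrable (fun s : UnitSphere d => (H s)⁻¹ *
      ∑ i, ∑ j, pderiv i H s * pderiv i (pderiv j H) s * pderiv j H s) (sphereMeasure d) :=
    SmoothOff.integrable (F := fun x => (H x)⁻¹ *
      ∑ i, ∑ j, pderiv i H x * pderiv i (pderiv j H) x * pderiv j H x)
      (ContDiffOn.mul hI (ContDiffOn.sum fun i _ =>
        ContDiffOn.sum fun j _ => ContDiffOn.mul (ContDiffOn.mul (hH.pderiv i)
          ((hH.pderiv j).pderiv i)) (hH.pderiv j)))
  have i12 : Integrable (fun s : UnitSphere d => (∑ i, pderiv i (pderiv i H) s) ^ 2 +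
      2 * c * ((H s)⁻¹ * (∑ i, pderiv i H s ^ 2) * ∑ i, pderiv i (pderiv i H) s))
      (sphereMeasure d) := i1.add (i2.const_mul _)
  have i45 : Integrable (fun s : UnitSphere d => ∑ i, ∑ j, pderiv i (pderiv j H) s ^ 2 -
      2 * ∑ i, pderiv i H s ^ 2) (sphereMeasure d) := i4.sub (i5.const_mul _)
  have i456 : Integrable (fun s : UnitSphere d => ∑ i, ∑ j, pderiv i (pderiv j H) s ^ 2 -
      2 * ∑ i, pderiv i H s ^ 2 + 2 * c * ((H s)⁻¹ *
        ∑ i, ∑ j, pderiv i H s * pderiv i (pderiv j H) s * pderiv j H s)) (sphereMeasure d) :=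
    i45.add (i6.const_mul _)
  have hmono := integral_mono (i12.add (i3.const_mul (c ^ 2)))
    ((i456.add (i3.const_mul (c ^ 2))).const_mul ((d : ℝ) - 1)) (fun s => ?_)
  · simp only [Pi.add_apply] at hmono
    rw [integral_const_mul, integral_add i12 (i3.const_mul _), integral_add i1 (i2.const_mul _),
      integral_add i456 (i3.const_mul _), integral_add i45 (i6.const_mul _),
      integral_sub i4 (i5.const_mul _)] at hmono
    simpa only [integral_const_mul] using hmono
  · have ha := sum_coord_mul_pderiv hH h0 s
    have hQ := sum_coord_mul_pderiv_pderiv hH h0 s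
    -- The choice α = 1 cancels the mixed part of the Euclidean Hessian, leaving the spherical one.
    have hform := sum_sq_symmetric_form (sum_sq_coord s) ha hQ
      (fun i j => pderiv_comm hH (ne_zero_of_mem_unit_sphere s) i j) 1 (c * (H s)⁻¹) 0
    have ht := sq_trace_le (s := fun i => s.1 i) (T := fun i j => pderiv i (pderiv j H) s +
      1 * (s.1 i * pderiv j H s + pderiv i H s * s.1 j) +
        c * (H s)⁻¹ * (pderiv i H s * pderiv j H s) + 0 * (if i = j then 1 else 0))
      (sum_sq_coord s) (by
        have e (i j : Fin d) : s.1 i * s.1 j * (pderiv i (pderiv j H) s +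
            1 * (s.1 i * pderiv j H s + pderiv i H s * s.1 j) +
            c * (H s)⁻¹ * (pderiv i H s * pderiv j H s) + 0 * (if i = j then 1 else 0)) =
            s.1 i * pderiv i (pderiv j H) s * s.1 j + s.1 i ^ 2 * (s.1 j * pderiv j H s) +
            s.1 i * pderiv i H s * s.1 j ^ 2 +
            c * (H s)⁻¹ * (s.1 i * pderiv i H s * (s.1 j * pderiv j H s)) := by
          ring
        simp only [e, Finset.sum_add_distrib, ← Finset.mul_sum, ← Finset.sum_mul, ha]
        rw [Finset.sum_comm]
        simp only [← Finset.sum_mul, hQ]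
        have ha' : ∑ i, -pderiv i H s * s.1 i = 0 := by
          rw [← neg_eq_zero, ← Finset.sum_neg_distrib, ← ha]
          exact Finset.sum_congr rfl fun i _ => by ring
        rw [ha']
        simp)
    rw [hform] at ht
    have htr : ∑ i, (pderiv i (pderiv i H) s +
        1 * (s.1 i * pderiv i H s + pderiv i H s * s.1 i) +
        c * (H s)⁻¹ * (pderiv i H s * pderiv i H s) + 0 * (if i = i then 1 else 0)) =
        ∑ i, pderiv i (pderiv i H) s + c * ((H s)⁻¹ * ∑ i, pderiv i H s ^ 2) := by
      have e (i : Fin d) : pderiv i (pderiv i H) s +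
          1 * (s.1 i * pderiv i H s + pderiv i H s * s.1 i) +
          c * (H s)⁻¹ * (pderiv i H s * pderiv i H s) + 0 * (if i = i then 1 else 0) =
          pderiv i (pderiv i H) s + 2 * (s.1 i * pderiv i H s) +
            c * (H s)⁻¹ * pderiv i H s ^ 2 := by
        ring
      rw [Finset.sum_congr rfl fun i _ => e i]
      simp only [Finset.sum_add_distrib, ← Finset.mul_sum, ha]
      ring
    rw [htr] at ht
    simp only [Pi.add_apply]
    linarith

end EvenPoincare

/-! ### Spherical derivatives in terms of the radial extension. -/

section RadialExtension

open MeasureTheory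
open scoped RealInnerProductSpace

variable {d : ℕ}

theorem radialExtension_of_ne_zero (g : UnitSphere d → ℝ) {x : EuclideanSpace ℝ (Fin d)}
    (hx : x ≠ 0) : radialExtension g x = g ⟨‖x‖⁻¹ • x, by
      simp [norm_smul, inv_mul_cancel₀ (norm_ne_zero_iff.mpr hx)]⟩ :=
  dif_neg hx

theorem radialExtension_coe (g : UnitSphere d → ℝ) (s : UnitSphere d) :
    radialExtension g s = g s := by
  rw [radialExtension_of_ne_zero g (ne_zero_of_mem_unit_sphere s)]
  congr 1
  ext1
  simp

theorem homogeneousOff_radialExtension (g : UnitSphere d → ℝ) :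
    HomogeneousOff 0 (radialExtension g) := by
  intro r hr x hx
  rw [radialExtension_of_ne_zero g hx, radialExtension_of_ne_zero g (smul_ne_zero hr.ne' hx),
    zpow_zero, one_mul]
  congr 2
  rw [norm_smul, Real.norm_of_nonneg hr.le, smul_smul, mul_inv, mul_right_comm,
    inv_mul_cancel₀ hr.ne', one_mul]

theorem radialExtension_neg {g : UnitSphere d → ℝ} (hg : ∀ s, g (-s) = g s)
    (x : EuclideanSpace ℝ (Fin d)) : radialExtension g (-x) = radialExtension g x := by
  rcases eq_or_ne x 0 with rfl | hx
  · rw [neg_zero]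
  · rw [radialExtension_of_ne_zero g hx, radialExtension_of_ne_zero g (neg_ne_zero.2 hx), ← hg]
    congr 1
    ext1
    simp

theorem smoothOff_radialExtension [NeZero d] {g : UnitSphere d → ℝ}
    (hg : ContMDiff (𝓡 (d - 1)) 𝓘(ℝ, ℝ) ∞ g) : SmoothOff (radialExtension g) := by
  intro x hx
  let O : TopologicalSpace.Opens (EuclideanSpace ℝ (Fin d)) := ⟨{0}ᶜ, isOpen_compl_zero⟩
  have hO (y : O) : y.1 ≠ 0 := y.2
  have h1 : ContMDiff 𝓘(ℝ, EuclideanSpace ℝ (Fin d)) 𝓘(ℝ, EuclideanSpace ℝ (Fin d)) ∞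
      fun y : O => ‖y.1‖⁻¹ • y.1 :=
    contDiffOn_normalize.contMDiffOn.comp_contMDiff contMDiff_subtype_val fun y => hO y
  have h2 : ContMDiff 𝓘(ℝ, EuclideanSpace ℝ (Fin d)) (𝓡 (d - 1)) ∞
      (Set.codRestrict (fun y : O => ‖y.1‖⁻¹ • y.1) (Metric.sphere 0 1) fun y => by
        simp [norm_smul, inv_mul_cancel₀ (norm_ne_zero_iff.mpr (hO y))]) :=
    h1.codRestrict_sphere _
  have h3 : ContMDiff 𝓘(ℝ, EuclideanSpace ℝ (Fin d)) 𝓘(ℝ, ℝ) ∞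
      fun y : O => radialExtension g y.1 := by
    convert hg.comp h2 using 1
    funext y
    rw [radialExtension_of_ne_zero g (hO y)]
    rfl
  have h4 := contMDiffAt_subtype_iff.1 (h3 ⟨x, hx⟩)
  exact (contMDiffAt_iff_contDiffAt.1 h4).contDiffWithinAt

theorem norm_sq_sphereGradient (g : UnitSphere d → ℝ) (s : UnitSphere d) :
    ‖sphereGradient g s‖ ^ 2 = ∑ i, pderiv i (radialExtension g) s ^ 2 := by
  rw [sphereGradient, gradient, LinearIsometryEquiv.norm_map, norm_sq_clm_eq_sum]
  rfl

/-- Expand both tangential projections: Euler's identity evaluates the Hessian on the normal s,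
giving minus the gradient in the mixed slots and 0 on (s, s). -/
theorem sphereHessian_single [NeZero d] {g : UnitSphere d → ℝ}
    (hg : SmoothOff (radialExtension g)) (s : UnitSphere d) (i j : Fin d) :
    sphereHessian g s (EuclideanSpace.single i 1) (EuclideanSpace.single j 1) =
      pderiv i (pderiv j (radialExtension g)) s +
        (s.1 i * pderiv j (radialExtension g) s + pderiv i (radialExtension g) s * s.1 j) := by
  have hs := ne_zero_of_mem_unit_sphere s
  have hd : DifferentiableAt ℝ (fderiv ℝ (radialExtension g)) s :=
    ((hg.contDiffAt hs).fderiv_right (m := 1) (by norm_cast)).differentiableAt (by simp)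
  have h1 (i j : Fin d) : fderiv ℝ (fderiv ℝ (radialExtension g)) s (EuclideanSpace.single i 1)
      (EuclideanSpace.single j 1) = pderiv i (pderiv j (radialExtension g)) s := by
    unfold pderiv
    rw [fderiv_clm_apply hd (differentiableAt_const _)]
    simp
  have hrad := sum_coord_mul_pderiv_pderiv hg (homogeneousOff_radialExtension g) s
  have hbasis : s.1 = ∑ k, s.1 k • EuclideanSpace.single k (1 : ℝ) := by
    conv_lhs => rw [← (EuclideanSpace.basisFun (Fin d) ℝ).sum_repr s.1]
    simp
  have h2 (j : Fin d) : fderiv ℝ (fderiv ℝ (radialExtension g)) s s.1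
      (EuclideanSpace.single j 1) = -pderiv j (radialExtension g) s := by
    rw [← hrad j]
    conv_lhs => enter [1, 2]; rw [hbasis]
    simp [map_sum, h1]
  have h3 (i : Fin d) : fderiv ℝ (fderiv ℝ (radialExtension g)) s (EuclideanSpace.single i 1)
      s.1 = -pderiv i (radialExtension g) s := by
    rw [← hrad i]
    conv_lhs => enter [2]; rw [hbasis]
    simp only [map_sum, map_smul, h1, smul_eq_mul]
    exact Finset.sum_congr rfl fun k _ => by rw [pderiv_comm hg hs]
  have h4 : fderiv ℝ (fderiv ℝ (radialExtension g)) s s.1 s.1 = 0 := by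
    conv_lhs => enter [2]; rw [hbasis]
    simp only [map_sum, map_smul, h2, smul_eq_mul, mul_neg, Finset.sum_neg_distrib]
    rw [sum_coord_mul_pderiv hg (homogeneousOff_radialExtension g), neg_zero]
  simp only [sphereHessian, tangentProjection, EuclideanSpace.inner_single_right, map_sub,
    map_smul, sub_apply, smul_apply, h1, h2, h3, h4]
  simp
  ring

end RadialExtension

/-! ### The substitution h = √f. -/

section SqrtExtension

open MeasureTheory

variable {d : ℕ}

theorem IsPositiveSymmetric.contMDiff_log [NeZero d] {f : UnitSphere d → ℝ}
    (hf : IsPositiveSymmetric f) :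
    ContMDiff (𝓡 (d - 1)) 𝓘(ℝ, ℝ) ∞ fun s => Real.log (f s) := by
  intro s
  have h : ContDiffAt ℝ ∞ Real.log (f s) := Real.contDiffAt_log.2 (hf.pos s).ne'
  exact h.contMDiffAt.comp s (hf.smooth s)

/-- The extension of `√f`, for a positive function `f` on the sphere. -/
noncomputable def sqrtExtension (f : UnitSphere d → ℝ) (x : EuclideanSpace ℝ (Fin d)) : ℝ :=
  Real.exp (1 / 2 * radialExtension (fun s => Real.log (f s)) x)


theorem homogeneousOff_sqrtExtension (f : UnitSphere d → ℝ) :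
    HomogeneousOff 0 (sqrtExtension f) := by
  intro r hr x hx
  rw [sqrtExtension, homogeneousOff_radialExtension _ r hr x hx, zpow_zero, one_mul, one_mul,
    sqrtExtension]

variable [NeZero d] {f : UnitSphere d → ℝ}

theorem sqrtExtension_sq (hf : IsPositiveSymmetric f) (s : UnitSphere d) :
    sqrtExtension f s ^ 2 = f s := by
  rw [sqrtExtension, radialExtension_coe, ← Real.exp_nat_mul]
  convert Real.exp_log (hf.pos s) using 2
  push_cast
  ring

theorem smoothOff_sqrtExtension (hf : IsPositiveSymmetric f) : SmoothOff (sqrtExtension f) :=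
  ContDiffOn.exp (ContDiffOn.mul contDiffOn_const (smoothOff_radialExtension hf.contMDiff_log))

theorem pderiv_sqrtExtension (hf : IsPositiveSymmetric f) (i : Fin d)
    {x : EuclideanSpace ℝ (Fin d)} (hx : x ≠ 0) :
    pderiv i (sqrtExtension f) x = 1 / 2 * (sqrtExtension f x *
      pderiv i (radialExtension fun s => Real.log (f s)) x) := by
  have hU := smoothOff_radialExtension hf.contMDiff_log
  have h : HasDerivAt (fun t : ℝ => Real.exp (1 / 2 * t))
      (Real.exp (1 / 2 * radialExtension (fun s => Real.log (f s)) x) * (1 / 2))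
      (radialExtension (fun s => Real.log (f s)) x) := by
    simpa using ((hasDerivAt_id (radialExtension (fun s => Real.log (f s)) x)).const_mul
      (1 / 2 : ℝ)).exp
  have := pderiv_scomp i h (hU.differentiableAt hx)
  change pderiv i (fun y => Real.exp (1 / 2 * radialExtension (fun s => Real.log (f s)) y)) x = _
  rw [this, sqrtExtension]
  ring

theorem pderiv_pderiv_sqrtExtension (hf : IsPositiveSymmetric f) (i j : Fin d)
    {x : EuclideanSpace ℝ (Fin d)} (hx : x ≠ 0) :
    pderiv i (pderiv j (sqrtExtension f)) x =
      sqrtExtension f x * (1 / 2 * pderiv i (pderiv j (radialExtension fun s => Real.log (f s))) x +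
        1 / 4 * (pderiv i (radialExtension fun s => Real.log (f s)) x *
          pderiv j (radialExtension fun s => Real.log (f s)) x)) := by
  have hU := smoothOff_radialExtension hf.contMDiff_log
  have hH := smoothOff_sqrtExtension hf
  have hm := ((hH.differentiableAt hx).mul ((hU.pderiv j).differentiableAt hx))
  rw [pderiv_congr i (fun y hy => pderiv_sqrtExtension hf j hy) hx,
    pderiv_scomp (F := fun y => sqrtExtension f y *
      pderiv j (radialExtension fun s => Real.log (f s)) y) (φ := fun t => 1 / 2 * t) i
      (by simpa using (hasDerivAt_id _).const_mul (1 / 2 : ℝ)) hm,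
    pderiv_mul i (hH.differentiableAt hx) ((hU.pderiv j).differentiableAt hx),
    pderiv_sqrtExtension hf i hx]
  ring

theorem mul_norm_sq_sphereGradient_log (hf : IsPositiveSymmetric f) (s : UnitSphere d) :
    f s * ‖sphereGradient (fun τ => Real.log (f τ)) s‖ ^ 2 =
      4 * ∑ i, pderiv i (sqrtExtension f) s ^ 2 := by
  rw [norm_sq_sphereGradient, ← sqrtExtension_sq hf, Finset.mul_sum, Finset.mul_sum]
  refine Finset.sum_congr rfl fun i _ => ?_
  rw [pderiv_sqrtExtension hf i (ne_zero_of_mem_unit_sphere s)]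
  ring

/-- This rests on ∇² log f = 2h⁻¹(∇²h - h⁻¹∇h⊗∇h). The coefficient d - 4 is the d - 2 of Γ₂ minus
the 2 that passes from the spherical to the Euclidean Hessian. -/
theorem mul_sphereGammaTwo_log (hf : IsPositiveSymmetric f) (s : UnitSphere d) :
    f s * sphereGammaTwo (fun τ => Real.log (f τ)) s =
      4 * (∑ i, ∑ j, pderiv i (pderiv j (sqrtExtension f)) s ^ 2 +
        ((d : ℝ) - 4) * ∑ i, pderiv i (sqrtExtension f) s ^ 2 -
        2 * ((sqrtExtension f s)⁻¹ * ∑ i, ∑ j, pderiv i (sqrtExtension f) s *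
          pderiv i (pderiv j (sqrtExtension f)) s * pderiv j (sqrtExtension f) s) +
        ((sqrtExtension f s)⁻¹ * ∑ i, pderiv i (sqrtExtension f) s ^ 2) ^ 2) := by
  have hH := smoothOff_sqrtExtension hf
  have h0 := homogeneousOff_sqrtExtension f
  have hs := ne_zero_of_mem_unit_sphere s
  have hpos : sqrtExtension f s ≠ 0 := (Real.exp_pos _).ne'
  have hform := sum_sq_symmetric_form (sum_sq_coord s) (sum_coord_mul_pderiv hH h0 s)
    (sum_coord_mul_pderiv_pderiv hH h0 s) (fun i j => pderiv_comm hH hs i j)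
    1 (-(sqrtExtension f s)⁻¹) 0
  have hhess : f s * sphereHessianNormSq (fun τ => Real.log (f τ)) s =
      4 * ∑ i, ∑ j, (pderiv i (pderiv j (sqrtExtension f)) s +
        1 * (s.1 i * pderiv j (sqrtExtension f) s + pderiv i (sqrtExtension f) s * s.1 j) +
        -(sqrtExtension f s)⁻¹ * (pderiv i (sqrtExtension f) s * pderiv j (sqrtExtension f) s) +
        0 * (if i = j then 1 else 0)) ^ 2 := by
    rw [sphereHessianNormSq, ← sqrtExtension_sq hf]
    simp only [Finset.mul_sum]
    refine Finset.sum_congr rfl fun i _ => Finset.sum_congr rfl fun j _ => ?_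
    rw [sphereHessian_single (smoothOff_radialExtension hf.contMDiff_log),
      pderiv_pderiv_sqrtExtension hf i j hs, pderiv_sqrtExtension hf i hs,
      pderiv_sqrtExtension hf j hs]
    field_simp
    ring
  rw [sphereGammaTwo, mul_add, hhess, hform, mul_left_comm, mul_norm_sq_sphereGradient_log hf]
  ring

end SqrtExtension

/-! ### The inequality and the optimal constant. -/

section OptimalConstant

open MeasureTheory

variable {d : ℕ} [NeZero d]

theorem gammaTwo_inequality (hd : 2 ≤ d) {f : UnitSphere d → ℝ} (hf : IsPositiveSymmetric f) :
    ((d : ℝ) + 3 - 1 / ((d : ℝ) - 1)) *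
        ∫ σ, f σ * ‖sphereGradient (fun τ => Real.log (f τ)) σ‖ ^ 2 ∂(sphereMeasure d) ≤
      ∫ σ, f σ * sphereGammaTwo (fun τ => Real.log (f τ)) σ ∂(sphereMeasure d) := by
  have hH := smoothOff_sqrtExtension hf
  have h0 := homogeneousOff_sqrtExtension f
  have hpos (x : EuclideanSpace ℝ (Fin d)) : 0 < sqrtExtension f x := Real.exp_pos _
  have heven (x : EuclideanSpace ℝ (Fin d)) : sqrtExtension f (-x) = sqrtExtension f x := by
    rw [sqrtExtension, radialExtension_neg (fun s => by rw [hf.symm]), sqrtExtension]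
  simp only [mul_norm_sq_sphereGradient_log hf, mul_sphereGammaTwo_log hf]
  have hbochner := integral_bochner hH h0
  have hparts := integral_hessian_gradient_gradient hH h0 hpos
  have htrace := integral_sq_laplacian_add_le hH h0 hpos
  have hgap := sphere_poincare_even hd hH h0 heven
  generalize sqrtExtension f = H at *
  have hN : SmoothOff fun x => ∑ j, pderiv j H x ^ 2 :=
    ContDiffOn.sum fun i _ => ContDiffOn.pow (hH.pderiv i) 2
  have hI : SmoothOff fun x => (H x)⁻¹ := ContDiffOn.inv hH fun x _ => (hpos x).ne'
  have i3 : Integrable (fun s : UnitSphere d => ((H s)⁻¹ * ∑ i, pderiv i H s ^ 2) ^ 2)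
      (sphereMeasure d) := SmoothOff.integrable (ContDiffOn.pow (ContDiffOn.mul hI hN) 2)
  have i4 : Integrable (fun s : UnitSphere d => ∑ i, ∑ j, pderiv i (pderiv j H) s ^ 2)
      (sphereMeasure d) :=
    SmoothOff.integrable (F := fun x => ∑ i, ∑ j, pderiv i (pderiv j H) x ^ 2)
      (ContDiffOn.sum fun i _ => ContDiffOn.sum fun j _ => ContDiffOn.pow ((hH.pderiv j).pderiv i) 2)
  have i5 : Integrable (fun s : UnitSphere d => ∑ i, pderiv i H s ^ 2) (sphereMeasure d) :=
    hN.integrable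
  have i6 : Integrable (fun s : UnitSphere d => (H s)⁻¹ *
      ∑ i, ∑ j, pderiv i H s * pderiv i (pderiv j H) s * pderiv j H s) (sphereMeasure d) :=
    SmoothOff.integrable (F := fun x => (H x)⁻¹ *
      ∑ i, ∑ j, pderiv i H x * pderiv i (pderiv j H) x * pderiv j H x)
      (ContDiffOn.mul hI (ContDiffOn.sum fun i _ =>
        ContDiffOn.sum fun j _ => ContDiffOn.mul (ContDiffOn.mul (hH.pderiv i)
          ((hH.pderiv j).pderiv i)) (hH.pderiv j)))
  have i45 : Integrable (fun s : UnitSphere d => ∑ i, ∑ j, pderiv i (pderiv j H) s ^ 2 +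
      ((d : ℝ) - 4) * ∑ i, pderiv i H s ^ 2) (sphereMeasure d) := i4.add (i5.const_mul _)
  have i456 : Integrable (fun s : UnitSphere d => ∑ i, ∑ j, pderiv i (pderiv j H) s ^ 2 +
      ((d : ℝ) - 4) * ∑ i, pderiv i H s ^ 2 - 2 * ((H s)⁻¹ *
        ∑ i, ∑ j, pderiv i H s * pderiv i (pderiv j H) s * pderiv j H s)) (sphereMeasure d) :=
    i45.sub (i6.const_mul _)
  rw [integral_const_mul, integral_const_mul, integral_add i456 i3, integral_sub i45
    (i6.const_mul _), integral_add i4 (i5.const_mul _), integral_const_mul, integral_const_mul]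
  have hG : 0 ≤ ∫ s : UnitSphere d, ∑ i, pderiv i H s ^ 2 ∂(sphereMeasure d) :=
    integral_nonneg fun _ => Finset.sum_nonneg fun _ _ => sq_nonneg _
  have hD : 0 ≤ ∫ s : UnitSphere d, ((H s)⁻¹ * ∑ i, pderiv i H s ^ 2) ^ 2 ∂(sphereMeasure d) :=
    integral_nonneg fun _ => sq_nonneg _
  generalize (∫ s : UnitSphere d, ∑ i, pderiv i H s ^ 2 ∂(sphereMeasure d)) = G at *
  generalize (∫ s : UnitSphere d, ((H s)⁻¹ * ∑ i, pderiv i H s ^ 2) ^ 2 ∂(sphereMeasure d)) = D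
    at *
  generalize (∫ s : UnitSphere d, ∑ i, ∑ j, pderiv i (pderiv j H) s ^ 2 ∂(sphereMeasure d)) = q
    at *
  generalize (∫ s : UnitSphere d, (H s)⁻¹ * ∑ i, ∑ j, pderiv i H s *
    pderiv i (pderiv j H) s * pderiv j H s ∂(sphereMeasure d)) = R at *
  generalize (∫ s : UnitSphere d, (∑ i, pderiv i (pderiv i H) s) ^ 2 ∂(sphereMeasure d)) = A at *
  generalize (∫ s : UnitSphere d, (H s)⁻¹ * (∑ i, pderiv i H s ^ 2) *
    ∑ i, pderiv i (pderiv i H) s ∂(sphereMeasure d)) = B at *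
  -- By Bochner and 2R = D - B, the expression q + (d - 4)G - 2R + D collapses to A + B.
  suffices h : ((d : ℝ) + 3 - 1 / ((d : ℝ) - 1)) * G ≤ A + B by linarith
  rcases hd.eq_or_lt with rfl | hd3
  -- On the circle, c = -1 turns the trace inequality into 3B ≥ D ≥ 0, and the gap A ≥ 4G concludes.
  · have := htrace (-1)
    norm_num at *
    linarith
  · obtain ⟨m, hm⟩ : ∃ m : ℝ, m = (d : ℝ) - 2 := ⟨_, rfl⟩
    have hm1 : 1 ≤ m := by
      have : (3 : ℝ) ≤ d := by exact_mod_cast hd3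
      linarith
    have hdm : (d : ℝ) = m + 2 := by linarith
    -- This c solves m c² + (m + 1)c = 0, which is exactly the vanishing of the coefficient of D; it
    -- requires m = d - 2 ≠ 0.
    have ht := htrace (-((m + 1) / m))
    rw [hdm] at hbochner hgap ht ⊢
    have hq : q = A - (m - 2) * G := by linarith
    have hR : R = (D - B) / 2 := by linarith
    rw [hq, hR] at ht
    have hB : -((m + 1) * (m + 3) * B) ≤ m ^ 2 * A - (m + 1) * m ^ 2 * G := by
      have hmpos : 0 < m := by linarith
      have ht' := mul_le_mul_of_nonneg_left ht hmpos.le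
      have e : m * ((m + 2 - 1) * (A - (m - 2) * G - 2 * G +
          2 * -((m + 1) / m) * ((D - B) / 2) + (-((m + 1) / m)) ^ 2 * D)) -
          m * (A + 2 * -((m + 1) / m) * B + (-((m + 1) / m)) ^ 2 * D) =
          m ^ 2 * A - (m + 1) * m ^ 2 * G + (m + 1) * (m + 3) * B := by
        field_simp
        ring
      linarith
    -- After `hB`, the remaining weight on A is (m + 1)(m + 3) - m² = 4m + 3, to which the gap A ≥
    -- 2(m + 2)G is applied.
    have h4 : (m + 3) * (((m + 1) ^ 2 + 4 * (m + 1) - 1) * G) ≤ (m + 3) * ((m + 1) * (A + B)) := by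
      nlinarith [mul_le_mul_of_nonneg_left hgap (show 0 ≤ 4 * m + 3 by linarith)]
    have h5 := le_of_mul_le_mul_left h4 (by linarith)
    have h6 : (m + 2 + 3 - 1 / (m + 2 - 1)) * G =
        (((m + 1) ^ 2 + 4 * (m + 1) - 1) * G) / (m + 1) := by
      have : m + 2 - 1 ≠ 0 := by linarith
      have : m + 1 ≠ 0 := by linarith
      field_simp
      ring
    rw [h6, div_le_iff₀ (by linarith)]
    linarith

/-- A single nonconstant test function bounds the admissible constants above, so that the supremum
is a genuine one. Here f = exp(x₀²), whose gradient is nonzero at (3/5, 4/5, 0, …). -/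
theorem exists_integral_gradient_pos (hd : 2 ≤ d) :
    ∃ f : UnitSphere d → ℝ, IsPositiveSymmetric f ∧
      0 < ∫ σ, f σ * ‖sphereGradient (fun τ => Real.log (f τ)) σ‖ ^ 2 ∂(sphereMeasure d) := by
  let i₀ : Fin d := ⟨0, by omega⟩
  let i₁ : Fin d := ⟨1, by omega⟩
  have h01 : i₀ ≠ i₁ := by simp [i₀, i₁]
  have hF : ContDiff ℝ ∞ fun x : EuclideanSpace ℝ (Fin d) => x i₀ ^ 2 :=
    (contDiff_euclidean.1 contDiff_id i₀).pow 2
  have hf : IsPositiveSymmetric fun s : UnitSphere d => Real.exp (s.1 i₀ ^ 2) :=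
    ⟨hF.exp.contMDiff.comp (contMDiff_coe_sphere (n := d - 1)), fun _ => Real.exp_pos _,
      fun s => by simp⟩
  refine ⟨_, hf, ?_⟩
  have hlog := smoothOff_radialExtension hf.contMDiff_log
  simp only [mul_norm_sq_sphereGradient_log hf]
  have hH := smoothOff_sqrtExtension hf
  set H := sqrtExtension fun s : UnitSphere d => Real.exp (s.1 i₀ ^ 2) with hHdef
  have hN : SmoothOff fun x => 4 * ∑ i, pderiv i H x ^ 2 :=
    ContDiffOn.mul contDiffOn_const (ContDiffOn.sum fun i _ => ContDiffOn.pow (hH.pderiv i) 2)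
  have hs : EuclideanSpace.single i₀ (3 / 5 : ℝ) + EuclideanSpace.single i₁ (4 / 5 : ℝ) ∈
      Metric.sphere (0 : EuclideanSpace ℝ (Fin d)) 1 := by
    rw [mem_sphere_zero_iff_norm, ← sq_eq_sq₀ (norm_nonneg _) zero_le_one, norm_add_sq_real]
    simp [EuclideanSpace.inner_single_left, h01]
    norm_num
  let s : UnitSphere d := ⟨_, hs⟩
  have hs0 : s.1 i₀ = 3 / 5 := by simp [s, h01]
  refine integral_pos_of_integrable_nonneg_nonzero (x := s) hN.continuous_sphere hN.integrable
    (fun _ => mul_nonneg (by norm_num) (Finset.sum_nonneg fun _ _ => sq_nonneg _)) ?_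
  have hne : pderiv i₀ H s ≠ 0 := by
    rw [hHdef, pderiv_sqrtExtension hf i₀ (ne_zero_of_mem_unit_sphere s),
      pderiv_congr (G := fun x => (‖x‖⁻¹ • x) i₀ ^ 2) i₀ (fun y hy => by
        rw [radialExtension_of_ne_zero _ hy, Real.log_exp]) (ne_zero_of_mem_unit_sphere s),
      pderiv_comp_normalize (F := fun x => x i₀ ^ 2) hF.contDiffOn]
    have e (j : Fin d) : pderiv j (fun x : EuclideanSpace ℝ (Fin d) => x i₀ ^ 2) s =
        2 * s.1 i₀ * if j = i₀ then 1 else 0 := by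
      rw [pderiv_scomp (F := fun x : EuclideanSpace ℝ (Fin d) => x i₀) j (φ := fun t => t ^ 2)
        (by simpa using hasDerivAt_pow 2 (s.1 i₀))
        ((SmoothOff.coord i₀).differentiableAt (ne_zero_of_mem_unit_sphere s)), pderiv_coord]
    simp only [e]
    have hpos : sqrtExtension (fun s : UnitSphere d => Real.exp (s.1 i₀ ^ 2)) s ≠ 0 :=
      (Real.exp_pos _).ne'
    simp [hs0, hpos]
    norm_num
  have : 0 < ∑ i, pderiv i H s ^ 2 :=
    Finset.sum_pos' (fun _ _ => sq_nonneg _) ⟨i₀, Finset.mem_univ _, by positivity⟩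
  positivity

theorem isGreatest_optimalGammaTwoConstant (hd : 2 ≤ d) :
    IsGreatest (gammaTwoConstants d) (optimalGammaTwoConstant d) := by
  have hmem : (d : ℝ) + 3 - 1 / ((d : ℝ) - 1) ∈ gammaTwoConstants d :=
    fun f hf => gammaTwo_inequality hd hf
  have hbdd : BddAbove (gammaTwoConstants d) := by
    obtain ⟨f, hf, hpos⟩ := exists_integral_gradient_pos hd
    exact ⟨_, fun c hc => (le_div_iff₀ hpos).2 (hc f hf)⟩
  refine ⟨fun f hf => ?_, fun c hc => le_csSup hbdd hc⟩
  have hG : 0 ≤ ∫ σ, f σ * ‖sphereGradient (fun τ => Real.log (f τ)) σ‖ ^ 2 ∂(sphereMeasure d) :=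
    integral_nonneg fun σ => mul_nonneg (hf.pos σ).le (sq_nonneg _)
  rcases hG.eq_or_lt with h | h
  -- If the gradient integral vanishes, the constant plays no role and any admissible one yields the
  -- inequality.
  · have := hmem f hf
    rw [← h, mul_zero] at this ⊢
    exact this
  · rw [← le_div_iff₀ h]
    exact csSup_le ⟨_, hmem⟩ fun c hc => (le_div_iff₀ h).2 (hc f hf)

theorem le_optimalGammaTwoConstant (hd : 2 ≤ d) :
    (d : ℝ) + 3 - 1 / ((d : ℝ) - 1) ≤ optimalGammaTwoConstant d :=
  (isGreatest_optimalGammaTwoConstant hd).2 fun _ hf => gammaTwo_inequality hd hf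

end OptimalConstant

theorem theorem1 :
    (∀ (d : ℕ) [NeZero d], 2 ≤ d →
      IsGreatest (gammaTwoConstants d) (optimalGammaTwoConstant d) ∧
      (d : ℝ) + 3 - 1 / ((d : ℝ) - 1) ≤ optimalGammaTwoConstant d) ∧
    (4 : ℝ) ≤ optimalGammaTwoConstant 2 ∧
    (11 / 2 : ℝ) ≤ optimalGammaTwoConstant 3 := by
  refine ⟨fun d _ hd => ⟨isGreatest_optimalGammaTwoConstant hd, le_optimalGammaTwoConstant hd⟩,
    le_trans ?_ (le_optimalGammaTwoConstant (d := 2) le_rfl),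
    le_trans ?_ (le_optimalGammaTwoConstant (d := 3) (by norm_num))⟩ <;>
  norm_num
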